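/- Let $K$ be an algebraically closed field of characteristic $2$ and let $n\ge 1$. Let $x_0,x_1,\dots,x_n$ be indeterminates, $x_0$ even and each $x_i$ ($1\le i\le n$) either even or odd, with $\deg x_0=2$, $\deg x_1=\dots=\deg x_n=1$. Functions are the elements of the divided power algebra $\mathcal O(N)=\mathrm{Span}_K\{x_0^{(r_0)}\cdots x_n^{(r_n)} : 0\le r_i<2^{N_i}\}$ with $x^{(r)}x^{(s)}=\prod_i\binom{r_i+s_i}{r_i}\,x^{(r+s)}$; here $N_i\in\{1,2,\dots,\infty\}$, and for $i\ge 1$ we have $N_i>1$ if $x_i$ is even and $N_i=1$ if $x_i$ is odd (so $x_i^2=0$). For a matrix $B\in K^{n\times n}$ set $$\alpha_B=dx_0+\sum_{i,j=1}^n B_{ij}\,x_i\,dx_j .$$ A 1-form $\alpha$ is an *odd contact form* if it is odd ($d$ being odd), it does not vanish at the point $x=0$, the distribution $\alpha=0$ is not integrable (not closed under brackets of vector fields and squares of odd vector fields), and $d\alpha$ is non-degenerate on the fiber of this distribution at $x=0$. In the last condition $d\alpha$ is regarded as a symmetric bilinear form together with a quadratic form on the odd vectors (since $(dx_i)^2\ne0$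 for odd $x_i$); non-degenerate means that no nonzero even vector is orthogonal to the whole fiber, and no nonzero odd vector is both orthogonal to the whole fiber and a zero of the quadratic form. A *degree-preserving coordinate system* is a set $x_0',\dots,x_n'\in\mathcal O(N)$ with invertible Jacobian matrix in which $x_i'$ is homogeneous of the degree and parity of $x_i$. We say that $\alpha_B$ *can be brought to* an expression in $x_0,\dots,x_n$ if $\alpha_B$ equals that expression written in some degree-preserving coordinate system $x'_0,\dots,x'_n$. **(a) Equal parities.** Let $x_1,\dots,x_n$ be all even or all odd. - If $n=2k$, then $dx_0+\sum_{i=1}^k x_i\,dx_{k+i}$ is an odd contact form, and $\alpha_B$ is an odd contact form if and only if it can be brought to this expression. - If $n=2k+1$ and $x_1,\dots,x_n$ are odd, then $dx_0+\sum_{i=1}^k x_i\,dx_{k+i}+x_n\,dx_n$ is an odd contact form, and $\alpha_B$ is an odd contact form if and only if it can be brought to this expression. - If $n$ is odd and $x_1,\dots,x_n$ are even, no $\alpha_B$ is an odd contact form. **(b) Mixed parities.** Let $n=n_0+n_1$, let $x_1,\dots,x_{n_0}$ be even and $x_{n_0+1},\dots,x_n$ odd. - If $n_0=2k$, put $l=\lfloor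 n_1/2\rfloor$, $t=x_0$, $p_i=x_i$, $q_i=x_{k+i}$ for $1\le i\le k$, $\xi_i=x_{n_0+i}$, $\eta_i=x_{n_0+l+i}$ for $1\le i\le l$, and $\theta=x_n$ if $n_1=2l+1$. Then $$dt+\sum_{i=1}^k p_i\,dq_i+\sum_{i=1}^l\xi_i\,d\eta_i\quad(n_1=2l),\qquad dt+\sum_{i=1}^k p_i\,dq_i+\sum_{i=1}^l\xi_i\,d\eta_i+\theta\,d\theta\quad(n_1=2l+1)$$ is an odd contact form, and $\alpha_B$ is an odd contact form if and only if it can be brought to this expression. - If $n_0$ is odd, no $\alpha_B$ is an odd contact form. -/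

import Mathlib

namespace OddContact

open Finset

/-! ### Divided powers -/

/-- The divided power algebra `𝒪(I)` over `K` in indeterminates indexed by `I`: the vector space with
basis the monomials `x^{(r)} = ∏ i, x_i^{(r_i)}`, `r : I → ℕ`.  An element is its finitely supported
family of coefficients. -/
def DivPow (K I : Type*) [Field K] : Type _ := (I → ℕ) →₀ K

section Algebra

variable {K I : Type*} [Field K]

noncomputable instance : AddCommGroup (DivPow K I) := inferInstanceAs (AddCommGroup ((I → ℕ) →₀ K))

noncomputable instance : Module K (DivPow K I) := inferInstanceAs (Module K ((I → ℕ) →₀ K))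

/-- The basis of monomials. -/
noncomputable def monoBasis (K I : Type*) [Field K] : Module.Basis (I → ℕ) K (DivPow K I) :=
  ⟨(LinearEquiv.refl K ((I → ℕ) →₀ K) : DivPow K I ≃ₗ[K] ((I → ℕ) →₀ K))⟩

/-- The monomial `x^{(r)}`. -/
noncomputable def mono (K : Type*) {I : Type*} [Field K] (r : I → ℕ) : DivPow K I := monoBasis K I r

/-- The coefficient of `f` at the monomial `x^{(r)}`. -/
noncomputable def coeff (r : I → ℕ) : DivPow K I →ₗ[K] K := (monoBasis K I).coord r

theorem coeff_mono [DecidableEq (I → ℕ)] (r s : I → ℕ) :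
    coeff r (mono K s) = if s = r then 1 else 0 := by
  simp [coeff, mono, Finsupp.single_apply]

theorem mono_induction {P : DivPow K I → Prop} (f : DivPow K I) (h0 : P 0)
    (hadd : ∀ f g, P f → P g → P (f + g)) (hm : ∀ (c : K) r, P (c • mono K r)) : P f := by
  have hf : f ∈ Submodule.span K (Set.range (monoBasis K I)) := by
    rw [Module.Basis.span_eq]; trivial
  obtain ⟨c, rfl⟩ := (Finsupp.mem_span_range_iff_exists_finsupp).1 hf
  exact Finset.sum_induction _ P hadd h0 fun r _ => hm _ _

/-- The indeterminate `x_i`. -/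
noncomputable def coord (K : Type*) {I : Type*} [Field K] [DecidableEq I] (i : I) : DivPow K I :=
  mono K (Pi.single i 1)

/-- The partial derivative `∂_i`, with `∂_i x_i^{(m+1)} = x_i^{(m)}` and `∂_i 1 = 0`. -/
noncomputable def partialD [DecidableEq I] (i : I) : DivPow K I →ₗ[K] DivPow K I :=
  (monoBasis K I).constr K fun r => if r i = 0 then 0 else mono K (r - Pi.single i 1)

theorem partialD_mono [DecidableEq I] (i : I) (r : I → ℕ) :
    partialD i (mono K r) = if r i = 0 then 0 else mono K (r - Pi.single i 1) := by
  rw [partialD, mono, Module.Basis.constr_basis]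

variable [Fintype I]

/-- The structure constant `∏ i, binom (r_i + s_i) (r_i)`. -/
def binomProd (r s : I → ℕ) : ℕ := ∏ i, (r i + s i).choose (r i)

/-- The bilinear product with `x^{(r)} * x^{(s)} = (∏ i, binom (r_i + s_i) (r_i)) x^{(r + s)}`. -/
noncomputable def mulLin : DivPow K I →ₗ[K] DivPow K I →ₗ[K] DivPow K I :=
  (monoBasis K I).constr K fun r => (monoBasis K I).constr K fun s =>
    (binomProd r s : K) • mono K (r + s)

noncomputable instance : Mul (DivPow K I) := ⟨fun f g => mulLin f g⟩

noncomputable instance : One (DivPow K I) := ⟨mono K 0⟩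

theorem mul_def (f g : DivPow K I) : f * g = mulLin f g := rfl

theorem mono_mul_mono (r s : I → ℕ) :
    mono K r * mono K s = (binomProd r s : K) • mono K (r + s) := by
  rw [mul_def]
  simp only [mulLin]
  rw [mono, Module.Basis.constr_basis, mono, Module.Basis.constr_basis]

theorem binomProd_comm (r s : I → ℕ) : binomProd r s = binomProd s r := by
  unfold binomProd
  refine Finset.prod_congr rfl fun i _ => ?_
  rw [Nat.add_comm, Nat.choose_symm_add]

theorem binomProd_assoc (r s t : I → ℕ) :
    binomProd r s * binomProd (r + s) t = binomProd s t * binomProd r (s + t) := by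
  unfold binomProd
  rw [← Finset.prod_mul_distrib, ← Finset.prod_mul_distrib]
  refine Finset.prod_congr rfl fun i _ => ?_
  have h := Nat.choose_mul (n := r i + s i + t i) (k := r i + s i) (s := r i) (Nat.le_add_right _ _)
  have e1 : r i + s i + t i - r i = s i + t i := by omega
  have e2 : r i + s i - r i = s i := by omega
  rw [e1, e2] at h
  simp only [Pi.add_apply]
  rw [Nat.mul_comm, h, Nat.mul_comm, Nat.add_assoc]

theorem add_mul' (f g h : DivPow K I) : (f + g) * h = f * h + g * h := by
  simp only [mul_def, map_add, LinearMap.add_apply]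

theorem mul_add' (f g h : DivPow K I) : f * (g + h) = f * g + f * h := by
  simp only [mul_def, map_add]

theorem zero_mul' (f : DivPow K I) : 0 * f = 0 := by
  simp only [mul_def, map_zero, LinearMap.zero_apply]

theorem mul_zero' (f : DivPow K I) : f * 0 = 0 := by
  simp only [mul_def, map_zero]

theorem smul_mul' (c : K) (f g : DivPow K I) : (c • f) * g = c • (f * g) := by
  simp only [mul_def, map_smul, LinearMap.smul_apply]

theorem mul_smul' (c : K) (f g : DivPow K I) : f * (c • g) = c • (f * g) := by
  simp only [mul_def, map_smul]

theorem mul_comm' (f g : DivPow K I) : f * g = g * f := by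
  refine mono_induction (P := fun f => f * g = g * f) f (by rw [zero_mul', mul_zero'])
    (fun a b ha hb => by rw [add_mul', mul_add', ha, hb]) fun c r => ?_
  refine mono_induction (P := fun g => c • mono K r * g = g * c • mono K r) g (by rw [zero_mul', mul_zero'])
    (fun a b ha hb => by rw [add_mul', mul_add', ha, hb]) fun d s => ?_
  rw [smul_mul', mul_smul', smul_mul', mul_smul', mono_mul_mono, mono_mul_mono, binomProd_comm,
    add_comm, smul_comm c d]

theorem mul_assoc' (f g h : DivPow K I) : f * g * h = f * (g * h) := by
  refine mono_induction (P := fun f => f * g * h = f * (g * h)) f (by simp only [zero_mul'])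
    (fun a b ha hb => by simp only [add_mul', ha, hb]) fun c r => ?_
  refine mono_induction (P := fun g => c • mono K r * g * h = c • mono K r * (g * h)) g
    (by simp only [zero_mul', mul_zero'])
    (fun a b ha hb => by simp only [add_mul', mul_add', ha, hb]) fun d s => ?_
  refine mono_induction
    (P := fun h => c • mono K r * d • mono K s * h = c • mono K r * (d • mono K s * h)) h
    (by simp only [mul_zero'])
    (fun a b ha hb => by simp only [mul_add', ha, hb]) fun e t => ?_
  simp only [smul_mul', mul_smul', mono_mul_mono, smul_smul]
  rw [add_assoc]
  congr 1
  have := congrArg (Nat.cast (R := K)) (binomProd_assoc r s t)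
  push_cast at this
  linear_combination (c * d * e) * this

theorem one_mul' (f : DivPow K I) : 1 * f = f := by
  refine mono_induction (P := fun f => 1 * f = f) f (mul_zero' _) (fun a b ha hb => by rw [mul_add', ha, hb]) fun c r => ?_
  have h1 : (1 : DivPow K I) = mono K 0 := rfl
  rw [mul_smul', h1, mono_mul_mono]
  simp [binomProd]

noncomputable instance : CommRing (DivPow K I) :=
  { (inferInstance : AddCommGroup (DivPow K I)) with
    mul := (· * ·)
    one := 1
    left_distrib := mul_add'
    right_distrib := add_mul'
    zero_mul := zero_mul'
    mul_zero := mul_zero'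
    mul_assoc := mul_assoc'
    mul_comm := mul_comm'
    one_mul := one_mul'
    mul_one := fun f => by rw [mul_comm']; exact one_mul' f }

noncomputable instance : Algebra K (DivPow K I) := Algebra.ofModule smul_mul' mul_smul'

/-- Two natural numbers below `2 ^ m` whose sum is not below `2 ^ m` have an even binomial. -/
theorem two_dvd_choose {a b m : ℕ} (ha : a < 2 ^ m) (hb : b < 2 ^ m) (hab : 2 ^ m ≤ a + b) :
    2 ∣ (a + b).choose a := by
  have hm : m ≠ 0 := by rintro rfl; simp at ha hb; omega
  have hlog : Nat.log 2 (b + a) < m + 1 := by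
    refine Nat.log_lt_of_lt_pow (by have := Nat.two_pow_pos m; omega) ?_
    rw [pow_succ]; omega
  have h := padicValNat_choose' (p := 2) (n := b) (k := a) hlog
  have hpos : 0 < padicValNat 2 ((b + a).choose a) := by
    rw [h, Finset.card_pos]
    refine ⟨m, ?_⟩
    simp only [Finset.mem_filter, Finset.mem_Ico]
    refine ⟨by omega, ?_⟩
    rw [Nat.mod_eq_of_lt ha, Nat.mod_eq_of_lt hb]
    omega
  rw [add_comm]
  exact dvd_of_one_le_padicValNat hpos

/-- The algebra `𝒪(I, N)` for the shearing parameter `N` (characteristic 2): the span of the monomials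
`x^{(r)}` with `r_i < 2 ^ N_i` for all `i`, where `2 ^ ∞ = ∞`. -/
noncomputable def shearAlg (K : Type*) {I : Type*} [Field K] [CharP K 2] [Fintype I] (N : I → ℕ∞) :
    Subalgebra K (DivPow K I) where
  carrier := {f | ∀ r : I → ℕ, coeff r f ≠ 0 → ∀ (i : I) (m : ℕ), N i = m → r i < 2 ^ m}
  add_mem' := by
    intro f g hf hg r hr
    by_cases h : coeff r f = 0
    · refine hg r fun h' => hr ?_
      rw [map_add, h, h', add_zero]
    · exact hf r h
  mul_mem' := by
    classical
    intro f g hf hg t ht i m hi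
    by_contra hlt
    refine ht ?_
    have expand : ∀ f : DivPow K I, f = ∑ r ∈ ((monoBasis K I).repr f).support,
        coeff r f • mono K r := fun f => ((monoBasis K I).linearCombination_repr f).symm
    rw [expand f, expand g, Finset.sum_mul_sum, map_sum]
    refine Finset.sum_eq_zero fun r hr => ?_
    rw [map_sum]
    refine Finset.sum_eq_zero fun s hs => ?_
    have hr' := hf r (Finsupp.mem_support_iff.1 hr) i m hi
    have hs' := hg s (Finsupp.mem_support_iff.1 hs) i m hi
    rw [smul_mul', mul_smul', mono_mul_mono, map_smul, map_smul, map_smul, coeff_mono]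
    by_cases hrs : r + s = t
    · have h2 : 2 ∣ binomProd r s := by
        refine (two_dvd_choose hr' hs' ?_).trans (Finset.dvd_prod_of_mem _ (Finset.mem_univ i))
        rw [← hrs] at hlt
        simpa using hlt
      have h0 : (binomProd r s : K) = 0 := (CharP.cast_eq_zero_iff K 2 _).2 h2
      simp [h0]
    · simp [hrs]
  algebraMap_mem' := by
    classical
    intro c r hr i m hi
    have h1 : (algebraMap K (DivPow K I) c) = c • mono K 0 := Algebra.algebraMap_eq_smul_one c
    rw [h1, map_smul, coeff_mono] at hr
    have : (0 : I → ℕ) = r := by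
      by_contra h
      simp [h] at hr
    simp [← this]

end Algebra

/-! ### The superspace, its functions, vector fields and differential forms

Signs are omitted throughout, since the characteristic is 2.  A parity assignment `p : I → ZMod 2`
makes `x_i` even if `p i = 0` and odd if `p i = 1`; an odd `x_i` has shearing `N_i = 1`, which gives
`x_i ^ 2 = 0`. -/

section Super

variable {K I : Type*} [Field K] [Fintype I] [DecidableEq I]

/-- The function `f` is homogeneous of parity `e`. -/
def HasParity (p : I → ZMod 2) (e : ZMod 2) (f : DivPow K I) : Prop :=
  ∀ r : I → ℕ, coeff r f ≠ 0 → ∑ i, (r i : ZMod 2) * p i = e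

/-- The function `f` is homogeneous of degree `m` when `x_i` has degree `w i`. -/
def HasDegree (w : I → ℕ) (m : ℕ) (f : DivPow K I) : Prop :=
  ∀ r : I → ℕ, coeff r f ≠ 0 → ∑ i, r i * w i = m

/-- The differential `df = ∑ i, ∂_i f dx_i`.  The 1-form `∑ i, a_i dx_i` is represented by its family
of coefficients `a`. -/
noncomputable def diff (f : DivPow K I) : I → DivPow K I := fun i => partialD i f

/-- The value `α(X)` of a 1-form `α = ∑ i, α_i dx_i` on a vector field `X = ∑ i, X_i ∂_i`. -/
noncomputable def pairing (α X : I → DivPow K I) : DivPow K I := ∑ i, α i * X i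

/-- The (super)commutator of vector fields. -/
noncomputable def bracket (X Y : I → DivPow K I) : I → DivPow K I :=
  fun i => ∑ j, (X j * partialD j (Y i) + Y j * partialD j (X i))

/-- The square of an odd vector field, which is a vector field in characteristic 2. -/
noncomputable def square (X : I → DivPow K I) : I → DivPow K I :=
  fun i => ∑ j, X j * partialD j (X i)

/-- `X` is a vector field with coefficients in `𝒪(I, N)` lying in the distribution `α = 0`. -/
def InDistribution [CharP K 2] (N : I → ℕ∞) (α X : I → DivPow K I) : Prop :=
  (∀ i, X i ∈ shearAlg K N) ∧ pairing α X = 0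

/-- The distribution `α = 0` is integrable: it is closed under brackets and under squares of odd
vector fields. -/
def IsIntegrable [CharP K 2] (p : I → ZMod 2) (N : I → ℕ∞) (α : I → DivPow K I) : Prop :=
  (∀ X Y, InDistribution N α X → InDistribution N α Y → InDistribution N α (bracket X Y)) ∧
  (∀ X, InDistribution N α X → (∀ i, HasParity p (p i + 1) (X i)) → InDistribution N α (square X))

/-- The fiber of the distribution `α = 0` at the (unique) point of the superspace: the tangent vectors
`v = ∑ i, v_i ∂_i` killed by `α`. -/
def InFiber (α : I → DivPow K I) (v : I → K) : Prop := ∑ i, coeff 0 (α i) * v i = 0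

/-- The bilinear form on tangent vectors given by `dα = ∑ i j, ∂_i α_j dx_i dx_j`. -/
noncomputable def dBilin (α : I → DivPow K I) (v w : I → K) : K :=
  ∑ i, ∑ j, coeff 0 (partialD i (α j)) * (v i * w j + w i * v j)

/-- The quadratic form on odd tangent vectors given by `dα = ∑ i j, ∂_i α_j dx_i dx_j`.  (For odd
`x_i` the square of `dx_i` is not zero.)  The bilinear form above is its polar form. -/
noncomputable def dQuad (α : I → DivPow K I) (v : I → K) : K :=
  ∑ i, ∑ j, coeff 0 (partialD i (α j)) * (v i * v j)

/-- `v` is a homogeneous tangent vector of parity `e`. -/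
def VecParity (p : I → ZMod 2) (e : ZMod 2) (v : I → K) : Prop := ∀ i, v i ≠ 0 → p i = e

/-- `dα` is non-degenerate on the fiber of the distribution `α = 0`: no nonzero even vector of the fiber
is orthogonal to the fiber, and no nonzero odd vector of the fiber is both orthogonal to the fiber and
a zero of the quadratic form (non-degeneracy of a quadratic form in characteristic 2 over an
algebraically closed field). -/
def IsNondegenerate (p : I → ZMod 2) (α : I → DivPow K I) : Prop :=
  (∀ v, VecParity p 0 v → InFiber α v → (∀ w, InFiber α w → dBilin α v w = 0) → v = 0) ∧
  (∀ v, VecParity p 1 v → InFiber α v → (∀ w, InFiber α w → dBilin α v w = 0) →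
    dQuad α v = 0 → v = 0)

/-- `α` is an odd contact form on the superspace with parities `p` and shearing parameter `N`.  Since
`dx_i` has parity `p i + 1`, the form is odd if `α_i` has parity `p i`. -/
structure IsOddContact [CharP K 2] (p : I → ZMod 2) (N : I → ℕ∞) (α : I → DivPow K I) : Prop where
  mem : ∀ i, α i ∈ shearAlg K N
  odd : ∀ i, HasParity p (p i) (α i)
  /-- `α` does not vanish at the point, so that `α = 0` is a distribution of corank 1 -/
  nonvanishing : ∃ i, coeff 0 (α i) ≠ 0
  nonintegrable : ¬ IsIntegrable p N α
  nondegenerate : IsNondegenerate p α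

end Super

/-! ### Superspaces with coordinates `x_0, x_1, …, x_n`, where `x_0` is even -/

section Coordinates

variable {K : Type*} [Field K] {n : ℕ}

/-- The degrees: `deg x_0 = 2` and `deg x_1 = … = deg x_n = 1`. -/
def deg (n : ℕ) : Fin (n + 1) → ℕ := fun i => if i = 0 then 2 else 1

/-- Parities with `x_0` even and `x_1, …, x_n` all of parity `e`. -/
def pureParity (n : ℕ) (e : ZMod 2) : Fin (n + 1) → ZMod 2 := fun i => if i = 0 then 0 else e

/-- Parities with `x_0, …, x_{n₀}` even and `x_{n₀+1}, …, x_{n₀+n₁}` odd. -/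
def mixedParity (n₀ n₁ : ℕ) : Fin (n₀ + n₁ + 1) → ZMod 2 :=
  fun i => if (i : ℕ) ≤ n₀ then 0 else 1

/-- `N` is an admissible shearing parameter: `N_0 ≥ 1`, and for `1 ≤ i ≤ n` one has `N_i > 1` if `x_i` is
even and `N_i = 1` if `x_i` is odd. -/
def IsShearing (p : Fin (n + 1) → ZMod 2) (N : Fin (n + 1) → ℕ∞) : Prop :=
  1 ≤ N 0 ∧ ∀ i, i ≠ 0 → (p i = 0 → 1 < N i) ∧ (p i = 1 → N i = 1)

/-- `y_0, …, y_n` is a set of independent variables which are polynomials in `x_0, …, x_n` of the same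
degrees and parities as `x_0, …, x_n`. -/
def IsCoordSystem [CharP K 2] (p : Fin (n + 1) → ZMod 2) (N : Fin (n + 1) → ℕ∞)
    (y : Fin (n + 1) → DivPow K (Fin (n + 1))) : Prop :=
  (∀ i, y i ∈ shearAlg K N) ∧ (∀ i, HasDegree (deg n) (deg n i) (y i)) ∧
  (∀ i, HasParity p (p i) (y i)) ∧ IsUnit (Matrix.of fun i j => partialD j (y i)).det

/-- The 1-form `dx_0 + ∑_{i,j=1}^n B_{ij} x_i dx_j`. -/
noncomputable def bilinForm (B : Matrix (Fin n) (Fin n) K) : Fin (n + 1) → DivPow K (Fin (n + 1)) :=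
  diff (coord K 0) +
    ∑ i : Fin n, ∑ j : Fin n, B i j • (coord K i.succ • diff (coord K j.succ))

/-- The 1-form `dy_0 + ∑_{i=1}^k y_i dy_{k+i}`, where `n = 2k`, and the 1-form
`dy_0 + ∑_{i=1}^k y_i dy_{k+i} + y_n dy_n`, where `n = 2k + 1`. -/
noncomputable def canonForm (y : Fin (n + 1) → DivPow K (Fin (n + 1))) :
    Fin (n + 1) → DivPow K (Fin (n + 1)) :=
  diff (y 0) +
    ∑ i : Fin (n / 2), y ⟨i + 1, by omega⟩ • diff (y ⟨n / 2 + (i + 1), by omega⟩) +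
    if Odd n then y (Fin.last n) • diff (y (Fin.last n)) else 0

/-- The 1-form `dt + ∑_{i=1}^k p_i dq_i + ∑_{i=1}^l ξ_i dη_i`, where `n₀ = 2k` and `n₁ = 2l`, and the 1-form
`dt + ∑_{i=1}^k p_i dq_i + ∑_{i=1}^l ξ_i dη_i + θ dθ`, where `n₀ = 2k` and `n₁ = 2l + 1`.  Here
`t = y_0`, `p_i = y_i`, `q_i = y_{k+i}`, `ξ_i = y_{n₀+i}`, `η_i = y_{n₀+l+i}`, `θ = y_n`, `n = n₀ + n₁`. -/
noncomputable def canonSuperForm (n₀ n₁ : ℕ) (y : Fin (n₀ + n₁ + 1) → DivPow K (Fin (n₀ + n₁ + 1))) :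
    Fin (n₀ + n₁ + 1) → DivPow K (Fin (n₀ + n₁ + 1)) :=
  diff (y 0) +
    ∑ i : Fin (n₀ / 2), y ⟨i + 1, by omega⟩ • diff (y ⟨n₀ / 2 + (i + 1), by omega⟩) +
    ∑ i : Fin (n₁ / 2), y ⟨n₀ + (i + 1), by omega⟩ • diff (y ⟨n₀ + n₁ / 2 + (i + 1), by omega⟩) +
    if Odd n₁ then y (Fin.last _) • diff (y (Fin.last _)) else 0

end Coordinates

end OddContact

/-! At the point $x=0$ everything about $\alpha_B$ is read off from the matrix $B$. The fiber of the
distribution is $v_0=0$, and there $d\alpha_B$ is the quadratic form $q_B(v)=\sum B_{ij}v_iv_j$ with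
its polar form. The form $\alpha_B$ is odd exactly when $B$ has no entries between the two parities
(`ParityBlock`), and its non-degeneracy is `MatNondeg`. Non-integrability is then automatic: the
fields $\partial_a+(\alpha_B)_a\partial_0$ lie in the distribution, and the values at $0$ of their
brackets and squares recover $B_{ab}+B_{ba}$ and $B_{aa}$. So `isOddContact_bilinForm` turns the
problem into linear algebra.

In a degree-preserving coordinate system $y_0$ has degree 2 and the remaining $y_i$ have linear part
$A$, which is invertible and respects parity. Comparing coefficients in $\alpha_B=dy_0+\sum
C_{ij}y_i\,dy_j$ gives $B=S+A^{T}CA$, where $S$ holds the second-order coefficients of $y_0$. The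
matrix $S$ is symmetric, and $S_{ii}=0$ for odd $x_i$ because $x_i^{(2)}$ is not a function. In
characteristic 2 such an $S$ changes neither the polar form nor the quadratic form on odd vectors,
so non-degeneracy is invariant (`contact_of_coordSystem`). Conversely, if $q_B=q_C\circ A$, then
$S=B-A^{T}CA$ is alternating and is absorbed by $y_0=x_0+\sum_{i<j}S_{ij}x_ix_j$
(`exists_coordSystem`).

It remains to classify quadratic forms on the even and the odd vectors separately. Over an
algebraically closed field of characteristic 2 a non-degenerate form splits into hyperbolic planes
and at most one square (`exists_hyperbolic_family`). On even vectors the polar form itself must be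
non-degenerate; it is alternating, so the number of even $x_i$ is even. On odd vectors the square
may survive, and it gives the term $\theta\,d\theta$. -/

namespace OddContact

open Finset

/-! ### Taylor coefficients of order at most two at the origin -/

section Coefficients

variable {K I : Type*} [Field K]

theorem coeff_partialD [DecidableEq I] (i : I) (r : I → ℕ) (f : DivPow K I) :
    coeff r (partialD i f) = coeff (r + Pi.single i 1) f := by
  classical
  refine mono_induction (P := fun f => coeff r (partialD i f) = coeff (r + Pi.single i 1) f) f
    (by simp only [map_zero]) (fun f g hf hg => by simp only [map_add, hf, hg]) fun c s => ?_
  simp only [map_smul, partialD_mono, coeff_mono]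
  congr 1
  by_cases hs : s i = 0
  · rw [if_pos hs, map_zero, if_neg]
    rintro rfl
    simp at hs
  · rw [if_neg hs, coeff_mono]
    congr 1
    refine propext ⟨?_, ?_⟩
    · rintro rfl
      ext j
      by_cases hj : j = i
      · subst hj
        simp only [Pi.add_apply, Pi.sub_apply, Pi.single_eq_same]
        omega
      · simp [hj]
    · rintro rfl
      simp

theorem single_one_ne_zero [DecidableEq I] (i : I) : (Pi.single i 1 : I → ℕ) ≠ 0 := by
  intro h
  simpa using congrFun h i

theorem single_one_inj [DecidableEq I] {i j : I} :
    (Pi.single i 1 : I → ℕ) = Pi.single j 1 ↔ i = j := by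
  refine ⟨fun h => ?_, fun h => by rw [h]⟩
  by_contra hij
  simpa [hij] using congrFun h i

theorem coeff_zero_partialD [DecidableEq I] (i : I) (f : DivPow K I) :
    coeff 0 (partialD i f) = coeff (Pi.single i 1) f := by
  rw [coeff_partialD, zero_add]

theorem coeff_zero_coord [DecidableEq I] (i : I) : coeff 0 (coord K i) = 0 := by
  classical
  rw [coord, coeff_mono, if_neg (single_one_ne_zero i)]

theorem coeff_single_coord [DecidableEq I] (i j : I) :
    coeff (Pi.single i 1) (coord K j) = if i = j then 1 else 0 := by
  classical
  rw [coord, coeff_mono]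
  simp only [single_one_inj, eq_comm]

theorem partialD_coord [DecidableEq I] [Fintype I] (i j : I) :
    partialD i (coord K j) = if i = j then 1 else 0 := by
  rw [coord, partialD_mono]
  by_cases h : i = j
  · subst h
    simp
    rfl
  · simp [h]

theorem partialD_mono_add [DecidableEq I] {i j : I} (hij : i ≠ j) (l : I) :
    partialD l (mono K (Pi.single i 1 + Pi.single j 1)) =
      (if l = i then coord K j else 0) + if l = j then coord K i else 0 := by
  rw [partialD_mono]
  by_cases h : l = i
  · subst h
    simp [hij, coord]
  · by_cases h' : l = j
    · subst h'
      simp [hij.symm, coord]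
    · simp [h, h']

variable [Fintype I]

theorem coeff_zero_one : coeff (0 : I → ℕ) (1 : DivPow K I) = 1 := by
  classical
  have h : (1 : DivPow K I) = mono K 0 := rfl
  rw [h, coeff_mono, if_pos rfl]

theorem coeff_single_one [DecidableEq I] (i : I) :
    coeff (Pi.single i 1) (1 : DivPow K I) = 0 := by
  classical
  have h : (1 : DivPow K I) = mono K 0 := rfl
  rw [h, coeff_mono, if_neg (single_one_ne_zero i).symm]

theorem coeff_zero_mul (f g : DivPow K I) : coeff 0 (f * g) = coeff 0 f * coeff 0 g := by
  classical
  refine mono_induction (P := fun f => coeff 0 (f * g) = coeff 0 f * coeff 0 g) f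
    (by simp only [zero_mul, map_zero])
    (fun a b ha hb => by simp only [add_mul, map_add, ha, hb]) fun c r => ?_
  refine mono_induction (P := fun g => coeff 0 (c • mono K r * g) = coeff 0 (c • mono K r) * coeff 0 g)
    g (by simp only [mul_zero, map_zero])
    (fun a b ha hb => by simp only [mul_add, map_add, ha, hb]) fun d s => ?_
  rw [smul_mul', mul_smul', mono_mul_mono]
  simp only [map_smul, coeff_mono, smul_eq_mul]
  by_cases hr : r = 0
  · by_cases hs : s = 0
    · subst hr hs
      simp [binomProd]
    · subst hr
      simp [hs]
  · have h : r + s ≠ 0 := fun h => hr (add_eq_zero.1 h).1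
    simp [hr, h]

/-- The value of a function at the point of the superspace. -/
noncomputable def evalZero (K I : Type*) [Field K] [Fintype I] : DivPow K I →+* K where
  toFun := coeff 0
  map_one' := coeff_zero_one
  map_mul' := coeff_zero_mul
  map_zero' := map_zero _
  map_add' := map_add _

/-- The Leibniz rule at the origin. A monomial of total degree one factors only as itself times $1$,
so divided powers do not interfere. -/
theorem coeff_single_mul [DecidableEq I] (i : I) (f g : DivPow K I) :
    coeff (Pi.single i 1) (f * g) =
      coeff (Pi.single i 1) f * coeff 0 g + coeff 0 f * coeff (Pi.single i 1) g := by
  classical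
  refine mono_induction (P := fun f => coeff (Pi.single i 1) (f * g) =
      coeff (Pi.single i 1) f * coeff 0 g + coeff 0 f * coeff (Pi.single i 1) g) f
    (by simp only [zero_mul, map_zero, add_zero])
    (fun a b ha hb => by simp only [add_mul, map_add, ha, hb]; ring) fun c r => ?_
  refine mono_induction (P := fun g => coeff (Pi.single i 1) (c • mono K r * g) =
      coeff (Pi.single i 1) (c • mono K r) * coeff 0 g +
        coeff 0 (c • mono K r) * coeff (Pi.single i 1) g)
    g (by simp only [mul_zero, map_zero, add_zero])
    (fun a b ha hb => by simp only [mul_add, map_add, ha, hb]; ring) fun d s => ?_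
  rw [smul_mul', mul_smul', mono_mul_mono]
  simp only [map_smul, coeff_mono, smul_eq_mul]
  by_cases hr : r = 0
  · subst hr
    simp [binomProd, (single_one_ne_zero i).symm]
  by_cases hs : s = 0
  · subst hs
    simp [binomProd, (single_one_ne_zero i).symm]
  have h : r + s ≠ Pi.single i 1 := by
    intro h
    obtain ⟨a, ha⟩ := Function.ne_iff.1 hr
    obtain ⟨b, hb⟩ := Function.ne_iff.1 hs
    simp only [Pi.zero_apply] at ha hb
    have h1 := congrFun h a
    have h2 := congrFun h b
    simp only [Pi.add_apply, Pi.single_apply] at h1 h2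
    by_cases hai : a = i
    · by_cases hbi : b = i
      · subst hai hbi
        simp at h1
        omega
      · simp [hbi] at h2
        omega
    · simp [hai] at h1
      omega
  simp [h, hr, hs]

end Coefficients

/-! ### Stability of parity, degree and shearing -/

section Closure

variable {K I : Type*} [Field K] [Fintype I]

theorem HasParity.zero (p : I → ZMod 2) (e : ZMod 2) : HasParity p e (0 : DivPow K I) :=
  fun _ h => absurd (map_zero _) h

theorem HasParity.add {p : I → ZMod 2} {e : ZMod 2} {f g : DivPow K I} (hf : HasParity p e f)
    (hg : HasParity p e g) : HasParity p e (f + g) := by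
  intro r h
  by_cases h' : coeff r f = 0
  · exact hg r fun h'' => h (by rw [map_add, h', h'', add_zero])
  · exact hf r h'

theorem HasParity.smul {p : I → ZMod 2} {e : ZMod 2} {f : DivPow K I} {c : K}
    (hf : c ≠ 0 → HasParity p e f) : HasParity p e (c • f) := by
  intro r h
  rw [map_smul, smul_eq_mul] at h
  exact hf (left_ne_zero_of_mul h) r (right_ne_zero_of_mul h)

theorem HasParity.sum {p : I → ZMod 2} {e : ZMod 2} {ι : Type*} {s : Finset ι}
    {f : ι → DivPow K I} (hf : ∀ i ∈ s, HasParity p e (f i)) : HasParity p e (∑ i ∈ s, f i) :=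
  Finset.sum_induction f (HasParity p e) (fun _ _ => HasParity.add) (HasParity.zero p e) hf

theorem HasParity.mono {p : I → ZMod 2} {e : ZMod 2} {r : I → ℕ}
    (h : ∑ i, (r i : ZMod 2) * p i = e) : HasParity p e (mono K r) := by
  classical
  intro s hs
  rw [coeff_mono] at hs
  obtain rfl : r = s := by
    by_contra hrs
    simp [hrs] at hs
  exact h

theorem HasParity.coord [DecidableEq I] (p : I → ZMod 2) (i : I) :
    HasParity p (p i) (coord K i) :=
  HasParity.mono (by simp [Pi.single_apply])

theorem HasDegree.zero (w : I → ℕ) (m : ℕ) : HasDegree w m (0 : DivPow K I) :=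
  fun _ h => absurd (map_zero _) h

theorem HasDegree.add {w : I → ℕ} {m : ℕ} {f g : DivPow K I} (hf : HasDegree w m f)
    (hg : HasDegree w m g) : HasDegree w m (f + g) := by
  intro r h
  by_cases h' : coeff r f = 0
  · exact hg r fun h'' => h (by rw [map_add, h', h'', add_zero])
  · exact hf r h'

theorem HasDegree.smul {w : I → ℕ} {m : ℕ} {f : DivPow K I} (c : K)
    (hf : HasDegree w m f) : HasDegree w m (c • f) := by
  intro r h
  rw [map_smul, smul_eq_mul] at h
  exact hf r (right_ne_zero_of_mul h)

theorem HasDegree.sum {w : I → ℕ} {m : ℕ} {ι : Type*} {s : Finset ι}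
    {f : ι → DivPow K I} (hf : ∀ i ∈ s, HasDegree w m (f i)) : HasDegree w m (∑ i ∈ s, f i) :=
  Finset.sum_induction f (HasDegree w m) (fun _ _ => HasDegree.add) (HasDegree.zero w m) hf

theorem HasDegree.mono {w : I → ℕ} {m : ℕ} {r : I → ℕ} (h : ∑ i, r i * w i = m) :
    HasDegree w m (mono K r) := by
  classical
  intro s hs
  rw [coeff_mono] at hs
  obtain rfl : r = s := by
    by_contra hrs
    simp [hrs] at hs
  exact h

theorem HasDegree.coord [DecidableEq I] (w : I → ℕ) (i : I) :
    HasDegree w (w i) (coord K i) :=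
  HasDegree.mono (by simp [Pi.single_apply])

theorem mono_mem_shearAlg [CharP K 2] {N : I → ℕ∞} (hN : ∀ i, 1 ≤ N i) {r : I → ℕ}
    (hr : ∀ i, r i ≤ 1) : mono K r ∈ shearAlg K N := by
  classical
  intro s hs i m hm
  rw [coeff_mono] at hs
  obtain rfl : r = s := by
    by_contra hrs
    simp [hrs] at hs
  have h1 : 1 ≤ m := by
    have := hN i
    rw [hm] at this
    exact_mod_cast this
  calc r i ≤ 1 := hr i
    _ < 2 ^ 1 := by norm_num
    _ ≤ 2 ^ m := Nat.pow_le_pow_right (by norm_num) h1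

theorem coord_mem_shearAlg [CharP K 2] [DecidableEq I] {N : I → ℕ∞} (hN : ∀ i, 1 ≤ N i) (i : I) :
    coord K i ∈ shearAlg K N := by
  refine mono_mem_shearAlg hN fun j => ?_
  rw [Pi.single_apply]
  split_ifs <;> omega

end Closure

/-! ### The quadratic form of a matrix -/

section MatrixForms

variable {K : Type*} [Field K] {n : ℕ}

/-- The quadratic form `∑ i j, B i j * v i * v j`. -/
noncomputable def matQuad (B : Matrix (Fin n) (Fin n) K) : QuadraticForm K (Fin n → K) :=
  LinearMap.BilinMap.toQuadraticMap (Matrix.toLinearMap₂' K B)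

theorem matQuad_apply (B : Matrix (Fin n) (Fin n) K) (v : Fin n → K) :
    matQuad B v = ∑ i, ∑ j, B i j * (v i * v j) := by
  rw [matQuad, LinearMap.BilinMap.toQuadraticMap_apply, Matrix.toLinearMap₂'_apply]
  simp only [smul_eq_mul]
  refine sum_congr rfl fun i _ => sum_congr rfl fun j _ => ?_
  ring

theorem polar_matQuad (B : Matrix (Fin n) (Fin n) K) (v w : Fin n → K) :
    QuadraticMap.polar (matQuad B) v w = ∑ i, ∑ j, B i j * (v i * w j + w i * v j) := by
  rw [QuadraticMap.polar, matQuad_apply, matQuad_apply, matQuad_apply, ← sum_sub_distrib,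
    ← sum_sub_distrib]
  refine sum_congr rfl fun i _ => ?_
  rw [← sum_sub_distrib, ← sum_sub_distrib]
  refine sum_congr rfl fun j _ => ?_
  simp only [Pi.add_apply]
  ring

theorem matQuad_single (B : Matrix (Fin n) (Fin n) K) (i : Fin n) :
    matQuad B (Pi.single i 1) = B i i := by
  simp [matQuad_apply, Pi.single_apply]

theorem polar_matQuad_single (B : Matrix (Fin n) (Fin n) K) (i j : Fin n) :
    QuadraticMap.polar (matQuad B) (Pi.single i 1) (Pi.single j 1) = B i j + B j i := by
  simp [polar_matQuad, Pi.single_apply, mul_add, sum_add_distrib]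

/-- The matrix `B` has no entries mixing the two parities. -/
def ParityBlock (p : Fin n → ZMod 2) (B : Matrix (Fin n) (Fin n) K) : Prop :=
  ∀ i j, B i j ≠ 0 → p i = p j

/-- The alternating form of `B` is nondegenerate on even vectors, and its quadratic form is
nondegenerate on odd vectors. -/
def MatNondeg (p : Fin n → ZMod 2) (B : Matrix (Fin n) (Fin n) K) : Prop :=
  (∀ v, VecParity p 0 v → (∀ w, QuadraticMap.polar (matQuad B) v w = 0) → v = 0) ∧
  (∀ v, VecParity p 1 v → (∀ w, QuadraticMap.polar (matQuad B) v w = 0) → matQuad B v = 0 → v = 0)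

end MatrixForms

/-! ### Reduction of the contact condition to linear algebra -/

section ContactForms

variable {K : Type*} [Field K] {n : ℕ}

theorem parity_eq_zero_or_one : ∀ e : ZMod 2, e = 0 ∨ e = 1 := by decide

theorem bilinForm_zero (B : Matrix (Fin n) (Fin n) K) : bilinForm B 0 = 1 := by
  simp [bilinForm, diff, partialD_coord, Finset.sum_apply, (Fin.succ_ne_zero _).symm]

theorem bilinForm_succ (B : Matrix (Fin n) (Fin n) K) (j : Fin n) :
    bilinForm B j.succ = ∑ i, B i j • coord K i.succ := by
  simp [bilinForm, diff, partialD_coord, Finset.sum_apply]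

theorem coeff_zero_bilinForm_zero (B : Matrix (Fin n) (Fin n) K) :
    coeff 0 (bilinForm B 0) = 1 := by
  rw [bilinForm_zero, coeff_zero_one]

theorem coeff_zero_bilinForm_succ (B : Matrix (Fin n) (Fin n) K) (j : Fin n) :
    coeff 0 (bilinForm B j.succ) = 0 := by
  simp [bilinForm_succ, coeff_zero_coord]

theorem coeff_single_bilinForm_zero (B : Matrix (Fin n) (Fin n) K) (i : Fin (n + 1)) :
    coeff (Pi.single i 1) (bilinForm B 0) = 0 := by
  rw [bilinForm_zero, coeff_single_one]

theorem coeff_single_zero_bilinForm (B : Matrix (Fin n) (Fin n) K) (j : Fin (n + 1)) :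
    coeff (Pi.single 0 1) (bilinForm B j) = 0 := by
  refine Fin.cases (coeff_single_bilinForm_zero B 0) (fun j => ?_) j
  simp [bilinForm_succ, coeff_single_coord, (Fin.succ_ne_zero _).symm]

theorem coeff_single_bilinForm_succ (B : Matrix (Fin n) (Fin n) K) (i j : Fin n) :
    coeff (Pi.single i.succ 1) (bilinForm B j.succ) = B i j := by
  simp [bilinForm_succ, coeff_single_coord]

theorem inFiber_bilinForm (B : Matrix (Fin n) (Fin n) K) (v : Fin (n + 1) → K) :
    InFiber (bilinForm B) v ↔ v 0 = 0 := by
  simp [InFiber, Fin.sum_univ_succ, coeff_zero_bilinForm_zero, coeff_zero_bilinForm_succ]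

theorem dBilin_bilinForm (B : Matrix (Fin n) (Fin n) K) (v w : Fin (n + 1) → K) :
    dBilin (bilinForm B) v w =
      QuadraticMap.polar (matQuad B) (fun i => v i.succ) (fun i => w i.succ) := by
  simp [dBilin, polar_matQuad, Fin.sum_univ_succ (n := n), coeff_zero_partialD,
    coeff_single_bilinForm_zero, coeff_single_zero_bilinForm, coeff_single_bilinForm_succ]

theorem dQuad_bilinForm (B : Matrix (Fin n) (Fin n) K) (v : Fin (n + 1) → K) :
    dQuad (bilinForm B) v = matQuad B fun i => v i.succ := by
  simp [dQuad, matQuad_apply, Fin.sum_univ_succ (n := n), coeff_zero_partialD,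
    coeff_single_bilinForm_zero, coeff_single_zero_bilinForm, coeff_single_bilinForm_succ]

theorem vecParity_cons {p : Fin (n + 1) → ZMod 2} {e : ZMod 2} {v : Fin n → K}
    (hv : VecParity (fun i => p i.succ) e v) : VecParity p e (Fin.cons 0 v : Fin (n + 1) → K) := by
  intro i
  refine Fin.cases (fun h => absurd rfl h) (fun i h => hv i h) i

theorem isNondegenerate_bilinForm (p : Fin (n + 1) → ZMod 2) (B : Matrix (Fin n) (Fin n) K) :
    IsNondegenerate p (bilinForm B) ↔ MatNondeg (fun i => p i.succ) B := by
  have hcons : ∀ v : Fin (n + 1) → K, v 0 = 0 → (fun i : Fin n => v i.succ) = 0 → v = 0 := by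
    intro v h0 h
    ext i
    exact Fin.cases h0 (fun i => congrFun h i) i
  have htail : ∀ v : Fin n → K, (Fin.cons 0 v : Fin (n + 1) → K) = 0 → v = 0 := by
    intro v h
    ext i
    exact congrFun h i.succ
  simp only [IsNondegenerate, MatNondeg, inFiber_bilinForm, dBilin_bilinForm, dQuad_bilinForm]
  refine ⟨fun h => ⟨fun v hv hb => ?_, fun v hv hb hq => ?_⟩,
    fun h => ⟨fun v hv h0 hb => ?_, fun v hv h0 hb hq => ?_⟩⟩
  · exact htail v (h.1 _ (vecParity_cons hv) rfl fun w _ => hb _)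
  · exact htail v (h.2 _ (vecParity_cons hv) rfl (fun w _ => hb _) hq)
  · exact hcons v h0 (h.1 _ (fun i hi => hv i.succ hi) fun w => hb (Fin.cons 0 w) rfl)
  · exact hcons v h0 (h.2 _ (fun i hi => hv i.succ hi) (fun w => hb (Fin.cons 0 w) rfl) hq)

theorem one_le_shearing {p : Fin (n + 1) → ZMod 2} {N : Fin (n + 1) → ℕ∞} (hN : IsShearing p N)
    (i : Fin (n + 1)) : 1 ≤ N i := by
  by_cases hi : i = 0
  · rw [hi]
    exact hN.1
  · rcases parity_eq_zero_or_one (p i) with h | h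
    · exact ((hN.2 i hi).1 h).le
    · exact ((hN.2 i hi).2 h).ge

/-- The vector field `∂_a + α_a ∂_0`, which lies in the distribution `α = 0` for
`α = dx_0 + ∑ B_{ij} x_i dx_j`. -/
noncomputable def distField (B : Matrix (Fin n) (Fin n) K) (a : Fin n) :
    Fin (n + 1) → DivPow K (Fin (n + 1)) :=
  Fin.cons (bilinForm B a.succ) fun i => if i = a then 1 else 0

theorem bilinForm_mem_shearAlg [CharP K 2] {p : Fin (n + 1) → ZMod 2} {N : Fin (n + 1) → ℕ∞}
    (hN : IsShearing p N) (B : Matrix (Fin n) (Fin n) K) (i : Fin (n + 1)) :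
    bilinForm B i ∈ shearAlg K N := by
  refine Fin.cases ?_ (fun j => ?_) i
  · rw [bilinForm_zero]
    exact one_mem _
  · rw [bilinForm_succ]
    exact sum_mem fun i _ => Subalgebra.smul_mem _ (coord_mem_shearAlg (one_le_shearing hN) _) _

theorem inDistribution_distField [CharP K 2] {p : Fin (n + 1) → ZMod 2} {N : Fin (n + 1) → ℕ∞}
    (hN : IsShearing p N) (B : Matrix (Fin n) (Fin n) K) (a : Fin n) :
    InDistribution N (bilinForm B) (distField B a) := by
  refine ⟨fun i => ?_, ?_⟩
  · refine Fin.cases (bilinForm_mem_shearAlg hN B _) (fun i => ?_) i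
    simp only [distField, Fin.cons_succ]
    split_ifs
    · exact one_mem _
    · exact zero_mem _
  -- The component along $\partial_0$ and the component along $\partial_a$ both contribute
  -- $\alpha_a$, and these cancel in characteristic 2.
  · have h2 : ∀ f : DivPow K (Fin (n + 1)), f + f = 0 := fun f => by
      rw [← two_smul K, CharTwo.two_eq_zero, zero_smul]
    simp [pairing, Fin.sum_univ_succ, distField, bilinForm_zero, h2]

/-- At the origin $\alpha_B$ is just $dx_0$. Hence a bracket or square that stays in the
distribution has $\partial_0$-component vanishing there. -/
theorem coeff_zero_pairing_bilinForm (B : Matrix (Fin n) (Fin n) K)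
    (X : Fin (n + 1) → DivPow K (Fin (n + 1))) :
    coeff 0 (pairing (bilinForm B) X) = coeff 0 (X 0) := by
  simp [pairing, Fin.sum_univ_succ, coeff_zero_mul, bilinForm_zero, coeff_zero_bilinForm_succ]

theorem coeff_zero_bracket_distField (B : Matrix (Fin n) (Fin n) K) (a b : Fin n) :
    coeff 0 (bracket (distField B a) (distField B b) 0) = B a b + B b a := by
  simp [bracket, Fin.sum_univ_succ, distField, coeff_zero_mul, coeff_zero_partialD,
    coeff_zero_bilinForm_succ, coeff_single_bilinForm_succ, sum_add_distrib]

theorem coeff_zero_square_distField (B : Matrix (Fin n) (Fin n) K) (a : Fin n) :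
    coeff 0 (square (distField B a) 0) = B a a := by
  simp [square, Fin.sum_univ_succ, distField, coeff_zero_mul, coeff_zero_partialD,
    coeff_zero_bilinForm_succ, coeff_single_bilinForm_succ]

/-- The coefficient of $dx_j$ is $\sum_i B_{ij}x_i$, which has the parity of $x_j$ exactly when only
$x_i$ of that parity occur. -/
theorem odd_bilinForm {p : Fin (n + 1) → ZMod 2} (hp : p 0 = 0) {B : Matrix (Fin n) (Fin n) K} :
    (∀ i, HasParity p (p i) (bilinForm B i)) ↔ ParityBlock (fun i => p i.succ) B := by
  constructor
  · intro h i j hij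
    have := h j.succ (Pi.single i.succ 1) (by rwa [coeff_single_bilinForm_succ])
    simpa [Pi.single_apply] using this
  · intro h i
    refine Fin.cases ?_ (fun j => ?_) i
    · rw [bilinForm_zero, hp]
      exact HasParity.mono (by simp)
    · rw [bilinForm_succ]
      refine HasParity.sum fun i _ => HasParity.smul fun hij => ?_
      have : p j.succ = p i.succ := (h i j hij).symm
      rw [this]
      exact HasParity.coord p i.succ

theorem polar_matQuad_eq_zero {B : Matrix (Fin n) (Fin n) K} (h : ∀ i j, B i j + B j i = 0)
    (v w : Fin n → K) : QuadraticMap.polar (matQuad B) v w = 0 := by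
  rw [polar_matQuad]
  simp only [mul_add, sum_add_distrib]
  rw [sum_comm (f := fun i j => B i j * (w i * v j)), ← sum_add_distrib]
  refine sum_eq_zero fun i _ => ?_
  rw [← sum_add_distrib]
  refine sum_eq_zero fun j _ => ?_
  linear_combination v i * w j * h i j

/-- Closure under brackets makes the polar form vanish identically, so any basis vector lies in its
radical. This contradicts non-degeneracy at once for an even vector; for an odd one, closure under
squares also makes the quadratic form vanish on it. -/
theorem not_isIntegrable_bilinForm [CharP K 2] {p : Fin (n + 1) → ZMod 2} {N : Fin (n + 1) → ℕ∞}
    (hn : 0 < n) (hp : p 0 = 0) (hN : IsShearing p N) {B : Matrix (Fin n) (Fin n) K}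
    (hB : ParityBlock (fun i => p i.succ) B) (hB' : MatNondeg (fun i => p i.succ) B) :
    ¬ IsIntegrable p N (bilinForm B) := by
  rintro ⟨h1, h2⟩
  have hb : ∀ v w, QuadraticMap.polar (matQuad B) v w = 0 := polar_matQuad_eq_zero fun a b => by
    have h := (h1 _ _ (inDistribution_distField hN B a) (inDistribution_distField hN B b)).2
    rw [← coeff_zero_bracket_distField B a b, ← coeff_zero_pairing_bilinForm B, h, map_zero]
  let a : Fin n := ⟨0, hn⟩
  have hne : (Pi.single a 1 : Fin n → K) ≠ 0 := fun h => by simpa using congrFun h a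
  have hpar : VecParity (fun i => p i.succ) (p a.succ) (Pi.single a 1 : Fin n → K) := by
    intro i hi
    by_cases h : i = a
    · rw [h]
    · simp [h] at hi
  rcases parity_eq_zero_or_one (p a.succ) with he | he
  · rw [he] at hpar
    exact hne (hB'.1 _ hpar (hb _))
  · rw [he] at hpar
    refine hne (hB'.2 _ hpar (hb _) ?_)
    have hodd : ∀ i, HasParity p (p i + 1) (distField B a i) := by
      intro i
      refine Fin.cases ?_ (fun i => ?_) i
      · have h := (odd_bilinForm hp).2 hB a.succ
        rw [he] at h
        simpa [distField, hp] using h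
      · simp only [distField, Fin.cons_succ]
        split_ifs with h
        · rw [h, he]
          exact HasParity.mono (by simp; decide)
        · exact HasParity.zero _ _
    have h := (h2 _ (inDistribution_distField hN B a) hodd).2
    rw [matQuad_single, ← coeff_zero_square_distField B a, ← coeff_zero_pairing_bilinForm B, h,
      map_zero]

/-- Of the five clauses only oddness and non-degeneracy constrain $B$. The assumption $n>0$ serves
non-integrability, which needs a basis vector to test. -/
theorem isOddContact_bilinForm [CharP K 2] {p : Fin (n + 1) → ZMod 2} {N : Fin (n + 1) → ℕ∞}
    (hn : 0 < n) (hp : p 0 = 0) (hN : IsShearing p N) (B : Matrix (Fin n) (Fin n) K) :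
    IsOddContact p N (bilinForm B) ↔
      ParityBlock (fun i => p i.succ) B ∧ MatNondeg (fun i => p i.succ) B := by
  constructor
  · intro h
    exact ⟨(odd_bilinForm hp).1 h.odd, (isNondegenerate_bilinForm p B).1 h.nondegenerate⟩
  · rintro ⟨hB, hB'⟩
    exact
      { mem := bilinForm_mem_shearAlg hN B
        odd := (odd_bilinForm hp).2 hB
        nonvanishing := ⟨0, by rw [coeff_zero_bilinForm_zero]; exact one_ne_zero⟩
        nonintegrable := not_isIntegrable_bilinForm hn hp hN hB hB'
        nondegenerate := (isNondegenerate_bilinForm p B).2 hB' }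

end ContactForms

/-! ### Quadratic forms over an algebraically closed field of characteristic 2 -/

section NormalForm

variable {K : Type*} [Field K]

/-- A quadratic form is nondegenerate if no nonzero vector of the radical of its polar form is one
of its zeros. -/
def QuadNondeg {V : Type*} [AddCommGroup V] [Module K V] (q : QuadraticForm K V) : Prop :=
  ∀ v, (∀ w, QuadraticMap.polar q v w = 0) → q v = 0 → v = 0

variable {V : Type*} [AddCommGroup V] [Module K V]

theorem quad_add (q : QuadraticForm K V) (v w : V) :
    q (v + w) = q v + q w + QuadraticMap.polar q v w := QuadraticMap.map_add q v w

theorem polar_self_eq_zero [CharP K 2] (q : QuadraticForm K V) (v : V) :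
    QuadraticMap.polar q v v = 0 := by
  rw [QuadraticMap.polar_self, two_smul]
  exact CharTwo.add_self_eq_zero _

theorem exists_sq_mul_eq [IsAlgClosed K] {a : K} (ha : a ≠ 0) (b : K) : ∃ c : K, c * c * a = b := by
  obtain ⟨c, hc⟩ := IsAlgClosed.exists_pow_nat_eq (b / a) (n := 2) (by norm_num)
  refine ⟨c, ?_⟩
  rw [← pow_two, hc, div_mul_cancel₀ _ ha]

/-- If the polar form vanished, $q$ would be additive with $q(cv)=c^2q(v)$. Since square roots
exist, two independent vectors would then have a nonzero combination $cv+w$ killed by $q$, and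
non-degeneracy excludes it. -/
theorem exists_polar_ne_zero [IsAlgClosed K] [CharP K 2] (q : QuadraticForm K V)
    (hq : QuadNondeg q) (hV : 1 < Module.finrank K V) : ∃ v w, QuadraticMap.polar q v w ≠ 0 := by
  by_contra! h
  have : FiniteDimensional K V := Module.finite_of_finrank_pos (by omega)
  have : Nontrivial V := Module.nontrivial_of_finrank_pos (R := K) (by omega)
  obtain ⟨v, hv⟩ := exists_ne (0 : V)
  have hlt : (K ∙ v) < ⊤ := by
    refine lt_top_iff_ne_top.2 fun ht => ?_
    have h1 := finrank_span_singleton (K := K) hv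
    rw [ht, finrank_top] at h1
    omega
  obtain ⟨w, -, hw⟩ := SetLike.exists_of_lt hlt
  have hqv : q v ≠ 0 := fun h0 => hv (hq v (h v) h0)
  obtain ⟨c, hc⟩ := exists_sq_mul_eq hqv (q w)
  have h0 : c • v + w = 0 := by
    refine hq _ (fun u => h _ u) ?_
    rw [quad_add, h, QuadraticMap.map_smul, smul_eq_mul, hc, add_zero]
    exact CharTwo.add_self_eq_zero _
  refine hw (Submodule.mem_span_singleton.2 ⟨-c, ?_⟩)
  rw [neg_smul]
  exact neg_eq_of_add_eq_zero_right h0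

theorem exists_hyperbolic_pair [IsAlgClosed K] [CharP K 2] (q : QuadraticForm K V) {v w : V}
    (h : QuadraticMap.polar q v w ≠ 0) :
    ∃ e f, q e = 0 ∧ q f = 0 ∧ QuadraticMap.polar q e f = 1 := by
  have key : ∃ e f, q e = 0 ∧ QuadraticMap.polar q e f = 1 := by
    by_cases hv : q v = 0
    · refine ⟨v, (QuadraticMap.polar q v w)⁻¹ • w, hv, ?_⟩
      rw [QuadraticMap.polar_smul_right, smul_eq_mul, inv_mul_cancel₀ h]
    -- A zero of $q$ on the line $w+Kv$ is a root of $q(v)X^2+\mathrm{polar}(v,w)X+q(w)$. It still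
    -- pairs nontrivially with $v$, because the polar form is alternating.
    · obtain ⟨x, hx⟩ := IsAlgClosed.exists_root
        (Polynomial.C (q v) * Polynomial.X ^ 2 +
          Polynomial.C (QuadraticMap.polar q v w) * Polynomial.X + Polynomial.C (q w))
        (by rw [Polynomial.degree_quadratic hv]; norm_num)
      refine ⟨x • v + w, (QuadraticMap.polar q v w)⁻¹ • v, ?_, ?_⟩
      · rw [quad_add, QuadraticMap.map_smul, QuadraticMap.polar_smul_left]
        simp only [Polynomial.IsRoot, Polynomial.eval_add, Polynomial.eval_mul, Polynomial.eval_C,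
          Polynomial.eval_pow, Polynomial.eval_X] at hx
        simp only [smul_eq_mul]
        linear_combination hx
      · rw [QuadraticMap.polar_add_left, QuadraticMap.polar_smul_left,
          QuadraticMap.polar_smul_right, polar_self_eq_zero, QuadraticMap.polar_smul_right,
          QuadraticMap.polar_comm q w v, smul_zero, smul_zero, zero_add, smul_eq_mul,
          inv_mul_cancel₀ h]
  obtain ⟨e, f, he, hef⟩ := key
  -- Since $q(e)=0$ and $e$, $f$ pair to $1$, adding $q(f)e$ changes $q(f)$ to $2q(f)=0$ and keeps
  -- the pairing with $e$.
  refine ⟨e, f + q f • e, he, ?_, ?_⟩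
  · rw [quad_add, QuadraticMap.map_smul, he, QuadraticMap.polar_smul_right,
      QuadraticMap.polar_comm q f e, hef]
    simpa using CharTwo.add_self_eq_zero (q f)
  · rw [QuadraticMap.polar_add_right, QuadraticMap.polar_smul_right, polar_self_eq_zero, hef,
      smul_zero, add_zero]

/-- The orthogonal complement of two vectors for the polar form. -/
def orthPair (q : QuadraticForm K V) (e f : V) : Submodule K V :=
  LinearMap.ker ((q.polarBilin e).prod (q.polarBilin f))

theorem mem_orthPair {q : QuadraticForm K V} {e f v : V} :
    v ∈ orthPair q e f ↔ QuadraticMap.polar q e v = 0 ∧ QuadraticMap.polar q f v = 0 := by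
  simp [orthPair]

theorem finrank_orthPair [CharP K 2] [FiniteDimensional K V] {q : QuadraticForm K V} {e f : V}
    (hef : QuadraticMap.polar q e f = 1) :
    Module.finrank K (orthPair q e f) + 2 = Module.finrank K V := by
  have hs : Function.Surjective ((q.polarBilin e).prod (q.polarBilin f)) := by
    rintro ⟨a, b⟩
    refine ⟨a • f + b • e, ?_⟩
    simp [hef, QuadraticMap.polar_comm q f e, CharTwo.two_eq_zero]
  have h := LinearMap.finrank_range_add_finrank_ker ((q.polarBilin e).prod (q.polarBilin f))
  rw [LinearMap.range_eq_top.2 hs, finrank_top, Module.finrank_prod, Module.finrank_self] at h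
  rw [orthPair]
  omega

theorem exists_orthPair_add [CharP K 2] {q : QuadraticForm K V} {e f : V}
    (hef : QuadraticMap.polar q e f = 1) (w : V) :
    ∃ (u : orthPair q e f) (a b : K), w = u + (a • e + b • f) := by
  have hfe : QuadraticMap.polar q f e = 1 := by rw [QuadraticMap.polar_comm, hef]
  refine ⟨⟨w - (QuadraticMap.polar q f w • e + QuadraticMap.polar q e w • f), ?_⟩,
    QuadraticMap.polar q f w, QuadraticMap.polar q e w, (sub_add_cancel _ _).symm⟩
  rw [mem_orthPair]
  simp only [QuadraticMap.polar_sub_right, QuadraticMap.polar_add_right,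
    QuadraticMap.polar_smul_right, polar_self_eq_zero, hef, hfe, smul_eq_mul, mul_zero, mul_one,
    zero_add, add_zero, sub_self, and_self]

/-- The space is the hyperbolic plane plus its orthogonal complement, so the radical of the
restriction to the complement lies in the radical of the whole form. -/
theorem polar_eq_zero_of_orthPair [CharP K 2] {q : QuadraticForm K V} {e f : V}
    (hef : QuadraticMap.polar q e f = 1) (v : orthPair q e f)
    (h : ∀ w, QuadraticMap.polar (q.comp (orthPair q e f).subtype) v w = 0) (w : V) :
    QuadraticMap.polar q (v : V) w = 0 := by
  obtain ⟨he, hf⟩ := mem_orthPair.1 v.2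
  rw [QuadraticMap.polar_comm] at he hf
  obtain ⟨u, a, b, rfl⟩ := exists_orthPair_add hef w
  have hu : QuadraticMap.polar q (v : V) u = 0 := h u
  simp only [QuadraticMap.polar_add_right, QuadraticMap.polar_smul_right, he, hf, hu, smul_zero,
    add_zero]

theorem quadNondeg_orthPair [CharP K 2] {q : QuadraticForm K V} (hq : QuadNondeg q) {e f : V}
    (hef : QuadraticMap.polar q e f = 1) :
    QuadNondeg (q.comp (orthPair q e f).subtype) :=
  fun v h1 h2 => Subtype.ext (hq v (polar_eq_zero_of_orthPair hef v h1) h2)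

/-- Induction on $k$, splitting off one hyperbolic plane each time; in dimension one a square root
normalizes $q$ to a square. Linear independence is not recorded: the formula for $q$ forces it
later. For $\varepsilon=0$ the vector $g$ is a dummy. -/
theorem exists_hyperbolic_family [IsAlgClosed K] [CharP K 2] (ε : ℕ) (hε : ε < 2) (k : ℕ) :
    ∀ {V : Type*} [AddCommGroup V] [Module K V] [FiniteDimensional K V] (q : QuadraticForm K V),
      QuadNondeg q → Module.finrank K V = 2 * k + ε →
      ∃ (e f : Fin k → V) (g : V), (∀ w, QuadraticMap.polar q g w = 0) ∧
        ∀ (a b : Fin k → K) (c : K),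
          q (∑ i, a i • e i + ∑ i, b i • f i + c • g) = ∑ i, a i * b i + ε * (c * c) := by
  induction k with
  | zero =>
    intro V _ _ _ q hq hV
    obtain rfl | rfl : ε = 0 ∨ ε = 1 := by omega
    · exact ⟨0, 0, 0, QuadraticMap.polar_zero_left q, by simp⟩
    · have : Nontrivial V := Module.nontrivial_of_finrank_pos (R := K) (by omega)
      obtain ⟨v, hv⟩ := exists_ne (0 : V)
      have hrad : ∀ w, QuadraticMap.polar q v w = 0 := fun w => by
        obtain ⟨c, rfl⟩ := (finrank_eq_one_iff_of_nonzero' v hv).1 (by simpa using hV) w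
        rw [QuadraticMap.polar_smul_right, polar_self_eq_zero, smul_zero]
      have hqv : q v ≠ 0 := fun h0 => hv (hq v hrad h0)
      obtain ⟨c, hc⟩ := exists_sq_mul_eq hqv 1
      refine ⟨0, 0, c • v, fun w => ?_, fun a b d => ?_⟩
      · rw [QuadraticMap.polar_smul_left, hrad, smul_zero]
      simp [QuadraticMap.map_smul, hc]
  | succ k ih =>
    intro V _ _ _ q hq hV
    obtain ⟨v, w, hvw⟩ := exists_polar_ne_zero q hq (by omega)
    obtain ⟨e₀, f₀, he, hf, hef⟩ := exists_hyperbolic_pair q hvw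
    have hfin := finrank_orthPair hef
    obtain ⟨e, f, g, hg, h⟩ := ih (q.comp (orthPair q e₀ f₀).subtype) (quadNondeg_orthPair hq hef)
      (by omega)
    refine ⟨Fin.cons e₀ fun i => e i, Fin.cons f₀ fun i => f i, g,
      polar_eq_zero_of_orthPair hef g hg, fun a b c => ?_⟩
    set u := ∑ i, a i.succ • e i + ∑ i, b i.succ • f i + c • g with hu
    have hqu : q (u : V) = ∑ i : Fin k, a i.succ * b i.succ + ε * (c * c) :=
      h (fun i => a i.succ) (fun i => b i.succ) c
    have hsplit : ∑ i, a i • (Fin.cons e₀ (fun i => (e i : V)) : Fin (k + 1) → V) i +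
        ∑ i, b i • (Fin.cons f₀ (fun i => (f i : V)) : Fin (k + 1) → V) i + c • (g : V) =
        (a 0 • e₀ + b 0 • f₀) + u := by
      rw [Fin.sum_univ_succ, Fin.sum_univ_succ, hu]
      simp only [Fin.cons_zero, Fin.cons_succ, Submodule.coe_add, Submodule.coe_smul,
        Submodule.coe_sum]
      abel
    obtain ⟨hu1, hu2⟩ := mem_orthPair.1 u.2
    rw [hsplit, quad_add, hqu, quad_add, Fin.sum_univ_succ]
    simp only [QuadraticMap.polar_add_left, QuadraticMap.polar_smul_left,
      QuadraticMap.polar_smul_right, QuadraticMap.map_smul, he, hf, hef, hu1, hu2, smul_eq_mul]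
    ring

end NormalForm

/-! ### Effect of coordinate changes on the matrix -/

section CoordinateChange

variable {K : Type*} [Field K] {n : ℕ}

/-- The 1-form `dy_0 + ∑ C_{ij} y_i dy_j`. -/
noncomputable def formOf (C : Matrix (Fin n) (Fin n) K)
    (y : Fin (n + 1) → DivPow K (Fin (n + 1))) : Fin (n + 1) → DivPow K (Fin (n + 1)) :=
  diff (y 0) + ∑ i : Fin n, ∑ j : Fin n, C i j • (y i.succ • diff (y j.succ))

theorem formOf_coord (C : Matrix (Fin n) (Fin n) K) : formOf C (coord K) = bilinForm C := rfl

theorem formOf_apply (C : Matrix (Fin n) (Fin n) K) (y : Fin (n + 1) → DivPow K (Fin (n + 1)))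
    (l : Fin (n + 1)) : formOf C y l =
      partialD l (y 0) + ∑ i, ∑ j, C i j • (y i.succ * partialD l (y j.succ)) := by
  simp [formOf, diff, Finset.sum_apply]

theorem sum_sum_eq_zero_of_alternating {M : Fin n → Fin n → K} (h : ∀ i j, M i j + M j i = 0)
    (h0 : ∀ i, M i i = 0) : ∑ i, ∑ j, M i j = 0 := by
  rw [← sum_product']
  refine sum_involution (fun x _ => (x.2, x.1)) (fun x _ => h _ _) (fun x _ hx hxx => hx ?_)
    (fun x _ => mem_univ _) (fun x _ => rfl)
  obtain ⟨i, j⟩ := x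
  simp only [Prod.mk.injEq] at hxx
  rw [hxx.1]
  exact h0 i

theorem matQuad_eq_zero_of_alternating {S : Matrix (Fin n) (Fin n) K}
    (h : ∀ i j, S i j + S j i = 0) {v : Fin n → K} (h0 : ∀ i, v i ≠ 0 → S i i = 0) :
    matQuad S v = 0 := by
  rw [matQuad_apply]
  refine sum_sum_eq_zero_of_alternating (fun i j => ?_) fun i => ?_
  · linear_combination (v i * v j) * h i j
  · by_cases hi : v i = 0
    · simp [hi]
    · rw [h0 i hi, zero_mul]

theorem matQuad_mulVec (A C : Matrix (Fin n) (Fin n) K) (v : Fin n → K) :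
    matQuad C (A.mulVec v) = ∑ i, ∑ j, (∑ k, ∑ l, C k l * (A k i * A l j)) * (v i * v j) := by
  rw [matQuad_apply]
  simp only [Matrix.mulVec, dotProduct, sum_mul_sum]
  simp only [mul_sum, sum_mul]
  have h : ∀ F : Fin n → Fin n → Fin n → Fin n → K,
      ∑ k, ∑ l, ∑ i, ∑ j, F k l i j = ∑ i, ∑ j, ∑ k, ∑ l, F k l i j := by
    intro F
    calc ∑ k, ∑ l, ∑ i, ∑ j, F k l i j = ∑ k, ∑ i, ∑ l, ∑ j, F k l i j :=
          sum_congr rfl fun k _ => sum_comm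
      _ = ∑ i, ∑ k, ∑ l, ∑ j, F k l i j := sum_comm
      _ = ∑ i, ∑ k, ∑ j, ∑ l, F k l i j :=
          sum_congr rfl fun i _ => sum_congr rfl fun k _ => sum_comm
      _ = ∑ i, ∑ j, ∑ k, ∑ l, F k l i j := sum_congr rfl fun i _ => sum_comm
  rw [h]
  refine sum_congr rfl fun i _ => sum_congr rfl fun j _ => sum_congr rfl fun k _ =>
    sum_congr rfl fun l _ => ?_
  ring

theorem matQuad_eq_add {A B C S : Matrix (Fin n) (Fin n) K}
    (h : ∀ i j, B i j = S i j + ∑ k, ∑ l, C k l * (A k i * A l j)) (v : Fin n → K) :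
    matQuad B v = matQuad S v + matQuad C (A.mulVec v) := by
  rw [matQuad_mulVec, matQuad_apply, matQuad_apply]
  simp only [h, add_mul, sum_add_distrib]

theorem VecParity.mulVec {p : Fin n → ZMod 2} {A : Matrix (Fin n) (Fin n) K}
    (hA : ParityBlock p A) {e : ZMod 2} {v : Fin n → K} (hv : VecParity p e v) :
    VecParity p e (A.mulVec v) := by
  intro i hi
  obtain ⟨j, -, hj⟩ := exists_ne_zero_of_sum_ne_zero (show ∑ j, A i j * v j ≠ 0 from hi)
  rw [hA i j (left_ne_zero_of_mul hj), hv j (right_ne_zero_of_mul hj)]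

/-- The summand $S$ has zero polar form, and its quadratic form vanishes on odd vectors. Its
diagonal on even vectors may be nonzero, which is harmless because only the polar form is tested
there. -/
theorem MatNondeg.of_congruent {p : Fin n → ZMod 2} {A B C S : Matrix (Fin n) (Fin n) K}
    (h : ∀ i j, B i j = S i j + ∑ k, ∑ l, C k l * (A k i * A l j))
    (hS : ∀ i j, S i j + S j i = 0) (hS' : ∀ i, p i = 1 → S i i = 0)
    (hA : Function.Injective A.mulVec) (hA' : ParityBlock p A) (hC : MatNondeg p C) :
    MatNondeg p B := by
  have hsurj : Function.Surjective A.mulVec := by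
    have := LinearMap.injective_iff_surjective (f := A.mulVecLin)
    exact this.1 hA
  have hinj : ∀ v, A.mulVec v = 0 → v = 0 := fun v hv => hA (by rw [hv, Matrix.mulVec_zero])
  have hpolar : ∀ v, (∀ w, QuadraticMap.polar (matQuad B) v w = 0) →
      ∀ w, QuadraticMap.polar (matQuad C) (A.mulVec v) w = 0 := by
    intro v hv w
    obtain ⟨w, rfl⟩ := hsurj w
    have h1 := hv w
    have h2 := polar_matQuad_eq_zero hS v w
    simp only [QuadraticMap.polar, matQuad_eq_add h, Matrix.mulVec_add] at h1 h2 ⊢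
    linear_combination h1 - h2
  refine ⟨fun v hv hb => hinj v (hC.1 _ (hv.mulVec hA') (hpolar v hb)),
    fun v hv hb hq => hinj v (hC.2 _ (hv.mulVec hA') (hpolar v hb) ?_)⟩
  rw [matQuad_eq_add h, matQuad_eq_zero_of_alternating hS fun i hi => hS' i (hv i hi),
    zero_add] at hq
  exact hq

/-- The linear part of the coordinate functions `y_1, …, y_n` in `x_1, …, x_n`. -/
noncomputable def linearPart (y : Fin (n + 1) → DivPow K (Fin (n + 1))) :
    Matrix (Fin n) (Fin n) K :=
  Matrix.of fun i j => coeff (Pi.single j.succ 1) (y i.succ)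

theorem sum_single_mul_deg (i : Fin (n + 1)) :
    ∑ j, (Pi.single i 1 : Fin (n + 1) → ℕ) j * deg n j = deg n i := by
  simp [Pi.single_apply]

theorem sum_single_mul_parity (p : Fin (n + 1) → ZMod 2) (i : Fin (n + 1)) :
    ∑ j, (((Pi.single i 1 : Fin (n + 1) → ℕ) j : ℕ) : ZMod 2) * p j = p i := by
  simp [Pi.single_apply]

theorem deg_zero : deg n 0 = 2 := rfl

theorem deg_succ (i : Fin n) : deg n i.succ = 1 := if_neg (Fin.succ_ne_zero i)

theorem coeff_zero_of_hasDegree {m : ℕ} (hm : m ≠ 0) {f : DivPow K (Fin (n + 1))}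
    (hf : HasDegree (deg n) m f) : coeff 0 f = 0 := by
  by_contra h
  exact hm (by simpa using (hf 0 h).symm)

theorem coeff_single_of_hasDegree {m : ℕ} {i : Fin (n + 1)} (hm : deg n i ≠ m)
    {f : DivPow K (Fin (n + 1))} (hf : HasDegree (deg n) m f) : coeff (Pi.single i 1) f = 0 := by
  by_contra h
  exact hm (by rw [← hf _ h, sum_single_mul_deg])

theorem isUnit_det_of_linear {A : Matrix (Fin n) (Fin n) K} (hA : IsUnit A.det)
    {y : Fin (n + 1) → DivPow K (Fin (n + 1))} (h0 : partialD 0 (y 0) = 1)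
    (hy : ∀ i, y i.succ = ∑ j, A i j • coord K j.succ) :
    IsUnit (Matrix.of fun i j => partialD j (y i)).det := by
  -- The Jacobian matrix is block triangular: its column of $\partial_0$-derivatives is
  -- $(1,0,\dots,0)$, and the remaining block is the constant matrix $A$.
  have hsub : (Matrix.of fun i j => partialD j (y i)).submatrix (Fin.succAbove 0) Fin.succ =
      (algebraMap K (DivPow K (Fin (n + 1)))).mapMatrix A := by
    ext i j : 2
    simp [hy, partialD_coord, Algebra.algebraMap_eq_smul_one]
  have hcol : ∀ i : Fin n, partialD 0 (y i.succ) = 0 := fun i => by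
    simp [hy, partialD_coord, (Fin.succ_ne_zero _).symm]
  rw [Matrix.det_succ_column_zero, Fin.sum_univ_succ, hsub, ← RingHom.map_det]
  simp only [Matrix.of_apply, hcol, h0]
  simpa using hA.map (algebraMap K (DivPow K (Fin (n + 1))))

/-- The function `x_0 + ∑_{i<j} S_{ij} x_i x_j`. -/
noncomputable def quadFun (S : Matrix (Fin n) (Fin n) K) : DivPow K (Fin (n + 1)) :=
  coord K 0 + ∑ i : Fin n, ∑ j : Fin n,
    (if i < j then S i j else 0) • mono K (Pi.single i.succ 1 + Pi.single j.succ 1)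

theorem partialD_zero_quadFun (S : Matrix (Fin n) (Fin n) K) : partialD 0 (quadFun S) = 1 := by
  rw [quadFun, map_add, partialD_coord, if_pos rfl, map_sum, sum_eq_zero, add_zero]
  intro i _
  rw [map_sum]
  refine sum_eq_zero fun j _ => ?_
  have h : (Pi.single i.succ 1 + Pi.single j.succ 1 : Fin (n + 1) → ℕ) 0 = 0 := by
    simp [(Fin.succ_ne_zero _).symm]
  rw [map_smul, partialD_mono, if_pos h]
  exact smul_zero _

variable [CharP K 2] {p : Fin (n + 1) → ZMod 2} {N : Fin (n + 1) → ℕ∞}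
  {y : Fin (n + 1) → DivPow K (Fin (n + 1))}

theorem parityBlock_linearPart (hy : IsCoordSystem p N y) :
    ParityBlock (fun i => p i.succ) (linearPart y) := by
  intro i j hij
  have h := hy.2.2.1 i.succ _ hij
  rw [sum_single_mul_parity] at h
  exact h.symm

/-- For degree reasons $y_0$ has no linear term in $x_1,\dots,x_n$, so the Jacobian matrix at the
origin sends $(0,v)$ to $(0,Av)$. -/
theorem injective_linearPart (hy : IsCoordSystem p N y) :
    Function.Injective (linearPart y).mulVec := by
  have hdet := hy.2.2.2.map (evalZero K (Fin (n + 1)))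
  rw [RingHom.map_det, ← Matrix.isUnit_iff_isUnit_det] at hdet
  have hinj := Matrix.mulVec_injective_of_isUnit hdet
  intro v w hvw
  have hJ : ∀ v : Fin n → K, ((evalZero K (Fin (n + 1))).mapMatrix
      (Matrix.of fun i j => partialD j (y i))).mulVec (Fin.cons 0 v) =
        Fin.cons 0 ((linearPart y).mulVec v) := by
    intro v
    ext i
    have he : ∀ f, evalZero K (Fin (n + 1)) f = coeff 0 f := fun _ => rfl
    refine Fin.cases ?_ (fun i => ?_) i
    · have h : ∀ j : Fin n, coeff (Pi.single j.succ 1) (y 0) = 0 := fun j =>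
        coeff_single_of_hasDegree (by rw [deg_succ, deg_zero]; norm_num) (hy.2.1 0)
      simp [Matrix.mulVec, dotProduct, Fin.sum_univ_succ, he, coeff_zero_partialD, h]
    · simp [Matrix.mulVec, dotProduct, Fin.sum_univ_succ, he, coeff_zero_partialD, linearPart]
  have h := hinj ((hJ v).trans ((congrArg _ hvw).trans (hJ w).symm))
  ext i
  simpa using congrFun h i.succ

/-- Comparison of the coefficients of $x_i\,dx_j$. The functions $y_1,\dots,y_n$ vanish at the
origin, so in each product $y_k\,\partial_j y_l$ only the linear parts contribute. -/
theorem eq_of_bilinForm_eq_formOf {B C : Matrix (Fin n) (Fin n) K} (hy : IsCoordSystem p N y)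
    (h : bilinForm B = formOf C y) (i j : Fin n) :
    B i j = coeff (Pi.single i.succ 1 + Pi.single j.succ 1) (y 0) +
      ∑ k, ∑ l, C k l * (linearPart y k i * linearPart y l j) := by
  have h0 : ∀ k : Fin n, coeff 0 (y k.succ) = 0 := fun k =>
    coeff_zero_of_hasDegree (by rw [deg_succ]; norm_num) (hy.2.1 k.succ)
  rw [← coeff_single_bilinForm_succ B i j, h, formOf_apply]
  simp [coeff_partialD, coeff_single_mul, h0, linearPart]

theorem contact_of_coordSystem {B C : Matrix (Fin n) (Fin n) K}
    (hp : p 0 = 0) (hN : IsShearing p N) (hy : IsCoordSystem p N y)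
    (hC : ParityBlock (fun i => p i.succ) C) (hC' : MatNondeg (fun i => p i.succ) C)
    (h : bilinForm B = formOf C y) :
    ParityBlock (fun i => p i.succ) B ∧ MatNondeg (fun i => p i.succ) B := by
  have hB := eq_of_bilinForm_eq_formOf hy h
  have hA := parityBlock_linearPart hy
  refine ⟨fun i j hij => ?_, MatNondeg.of_congruent
    (S := Matrix.of fun i j => coeff (Pi.single i.succ 1 + Pi.single j.succ 1) (y 0)) hB
    (fun i j => ?_) (fun i hi => ?_) (injective_linearPart hy) hA hC'⟩
  · by_cases h0 : coeff (Pi.single i.succ 1 + Pi.single j.succ 1) (y 0) = 0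
    · rw [hB, h0, zero_add] at hij
      obtain ⟨k, -, hk⟩ := exists_ne_zero_of_sum_ne_zero hij
      obtain ⟨l, -, hl⟩ := exists_ne_zero_of_sum_ne_zero hk
      have h1 := hC k l (left_ne_zero_of_mul hl)
      have h2 := hA k i (left_ne_zero_of_mul (right_ne_zero_of_mul hl))
      have h3 := hA l j (right_ne_zero_of_mul (right_ne_zero_of_mul hl))
      exact h2.symm.trans (h1.trans h3)
    · have h1 := hy.2.2.1 0 _ h0
      simp only [Pi.add_apply, Nat.cast_add, add_mul, sum_add_distrib,
        sum_single_mul_parity, hp] at h1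
      exact CharTwo.add_eq_zero.1 h1
  · simp only [Matrix.of_apply]
    rw [add_comm (Pi.single j.succ 1)]
    exact CharTwo.add_self_eq_zero _
  · by_contra h0
    -- A nonzero diagonal entry would put $x_i^{(2)}$ into $y_0$, but $N_i=1$ allows only exponents
    -- below $2$.
    have h1 := hy.1 0 _ h0 i.succ 1 (by exact_mod_cast (hN.2 _ (Fin.succ_ne_zero i)).2 hi)
    simp at h1

theorem partialD_succ_quadFun {S : Matrix (Fin n) (Fin n) K} (hS : ∀ i j, S i j + S j i = 0)
    (hS' : ∀ i, S i i = 0) (l : Fin n) :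
    partialD l.succ (quadFun S) = ∑ i, S i l • coord K i.succ := by
  have h1 : ∀ i j : Fin n, partialD l.succ
      ((if i < j then S i j else 0) • mono K (Pi.single i.succ 1 + Pi.single j.succ 1)) =
        (if l = i then (if i < j then S i j else 0) • coord K j.succ else 0) +
          if l = j then (if i < j then S i j else 0) • coord K i.succ else 0 := by
    intro i j
    by_cases hij : i < j
    · have hne : i.succ ≠ j.succ := fun h => hij.ne (Fin.succ_injective _ h)
      rw [map_smul, partialD_mono_add hne]
      simp [smul_add, Fin.succ_inj]
    · simp [hij]
  rw [quadFun, map_add, partialD_coord, if_neg (Fin.succ_ne_zero l), zero_add]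
  simp only [map_sum, h1, sum_add_distrib]
  rw [sum_comm (f := fun i j => if l = i then (if i < j then S i j else 0) • coord K j.succ else 0)]
  simp only [sum_ite_eq, mem_univ, if_true]
  rw [← sum_add_distrib]
  refine sum_congr rfl fun i _ => ?_
  rw [← add_smul]
  congr 1
  have hs : S l i = S i l := by
    have := CharTwo.add_eq_zero.1 (hS l i)
    exact this
  rcases lt_trichotomy l i with h | h | h
  · simp [h, h.not_gt, hs]
  · subst h
    simp [hS']
  · simp [h, h.not_gt]

/-- The matrices $B$ and $A^{T}CA$ have the same quadratic form, hence differ by an alternating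
matrix $S$. The form $\sum S_{ij}x_i\,dx_j$ is then the differential of $\sum_{i<j}S_{ij}x_ix_j$, a
square-free function available for every shearing. -/
theorem exists_coordSystem (hp : p 0 = 0) (hN : IsShearing p N) {A B C : Matrix (Fin n) (Fin n) K}
    (hB : ParityBlock (fun i => p i.succ) B) (hC : ParityBlock (fun i => p i.succ) C)
    (hA : ParityBlock (fun i => p i.succ) A) (hdet : IsUnit A.det)
    (h : ∀ v, matQuad B v = matQuad C (A.mulVec v)) :
    ∃ y, IsCoordSystem p N y ∧ bilinForm B = formOf C y := by
  set T : Matrix (Fin n) (Fin n) K :=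
    Matrix.of fun i j => ∑ k, ∑ l, C k l * (A k i * A l j) with hT
  -- In characteristic 2 this sum is the difference $B-A^{T}CA$.
  set S : Matrix (Fin n) (Fin n) K := B + T with hS
  have h2 : ∀ a : K, a + a = 0 := CharTwo.add_self_eq_zero
  have hq : matQuad S = 0 := by
    ext v
    have h1 := matQuad_mulVec A C v
    rw [← h, matQuad_apply] at h1
    rw [matQuad_apply]
    simp only [hS, hT, Matrix.add_apply, Matrix.of_apply, add_mul, sum_add_distrib]
    rw [h1]
    exact h2 _
  have hSS : ∀ i j, S i j + S j i = 0 := fun i j => by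
    rw [← polar_matQuad_single, hq]
    simp [QuadraticMap.polar]
  have hS0 : ∀ i, S i i = 0 := fun i => by
    rw [← matQuad_single S i, hq]
    rfl
  have hTpar : ∀ i j, T i j ≠ 0 → p i.succ = p j.succ := by
    intro i j hij
    rw [hT, Matrix.of_apply] at hij
    obtain ⟨k, -, hk⟩ := exists_ne_zero_of_sum_ne_zero hij
    obtain ⟨l, -, hl⟩ := exists_ne_zero_of_sum_ne_zero hk
    have h1 := hC k l (left_ne_zero_of_mul hl)
    have h2 := hA k i (left_ne_zero_of_mul (right_ne_zero_of_mul hl))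
    have h3 := hA l j (right_ne_zero_of_mul (right_ne_zero_of_mul hl))
    exact h2.symm.trans (h1.trans h3)
  have hSpar : ∀ i j, S i j ≠ 0 → p i.succ = p j.succ := by
    intro i j hij
    by_cases h0 : B i j = 0
    · exact hTpar i j (by simpa [hS, h0] using hij)
    · exact hB i j h0
  have hN1 := one_le_shearing hN
  let y : Fin (n + 1) → DivPow K (Fin (n + 1)) :=
    Fin.cons (quadFun S) fun i => ∑ j, A i j • coord K j.succ
  have hy : ∀ i : Fin n, y i.succ = ∑ j, A i j • coord K j.succ := fun _ => rfl
  have hy0 : y 0 = quadFun S := rfl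
  refine ⟨y, ⟨fun i => ?_, fun i => ?_, fun i => ?_, ?_⟩, ?_⟩
  · refine Fin.cases ?_ (fun i => ?_) i
    · rw [hy0, quadFun]
      refine add_mem (coord_mem_shearAlg hN1 0) (sum_mem fun i _ => sum_mem fun j _ => ?_)
      split_ifs with hij
      · refine Subalgebra.smul_mem _ (mono_mem_shearAlg hN1 fun l => ?_) _
        have : ¬ (l = i.succ ∧ l = j.succ) := fun h =>
          hij.ne (Fin.succ_injective _ (h.1.symm.trans h.2))
        simp only [Pi.add_apply, Pi.single_apply]
        split_ifs <;> simp_all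
      · rw [zero_smul]
        exact zero_mem _
    · rw [hy]
      exact sum_mem fun j _ => Subalgebra.smul_mem _ (coord_mem_shearAlg hN1 _) _
  · refine Fin.cases ?_ (fun i => ?_) i
    · rw [hy0, quadFun]
      refine (HasDegree.coord (deg n) 0).add (HasDegree.sum fun i _ => HasDegree.sum fun j _ =>
        HasDegree.smul _ (HasDegree.mono ?_))
      simp only [Pi.add_apply, add_mul, sum_add_distrib, sum_single_mul_deg, deg_succ, deg_zero]
    · rw [hy, deg_succ]
      refine HasDegree.sum fun j _ => HasDegree.smul _ ?_
      have h := HasDegree.coord (K := K) (deg n) j.succ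
      rwa [deg_succ] at h
  · refine Fin.cases ?_ (fun i => ?_) i
    · rw [hy0, quadFun]
      refine (HasParity.coord p 0).add (HasParity.sum fun i _ => HasParity.sum fun j _ =>
        HasParity.smul fun hij => HasParity.mono ?_)
      have hne : S i j ≠ 0 := by
        intro h0
        simp [h0] at hij
      simp only [Pi.add_apply, Nat.cast_add, add_mul, sum_add_distrib, sum_single_mul_parity, hp,
        hSpar i j hne]
      exact CharTwo.add_self_eq_zero _
    · rw [hy]
      refine HasParity.sum fun j _ => HasParity.smul fun hij => ?_
      have : p i.succ = p j.succ := hA i j hij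
      rw [this]
      exact HasParity.coord p _
  · exact isUnit_det_of_linear hdet (partialD_zero_quadFun S) hy
  · have hd : ∀ j l : Fin n, partialD l.succ (y j.succ) = A j l • 1 := fun j l => by
      simp [hy, partialD_coord]
    have hd0 : ∀ j : Fin n, partialD 0 (y j.succ) = 0 := fun j => by
      simp [hy, partialD_coord, (Fin.succ_ne_zero _).symm]
    funext l
    rw [formOf_apply, hy0]
    refine Fin.cases ?_ (fun l => ?_) l
    · simp [bilinForm_zero, partialD_zero_quadFun, hd0]
    · rw [bilinForm_succ, partialD_succ_quadFun hSS hS0]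
      have hsum : ∑ i, ∑ j, C i j • (y i.succ * partialD l.succ (y j.succ)) =
          ∑ i, T i l • coord K i.succ := by
        simp only [hd, mul_smul', mul_one]
        simp only [hy, smul_sum, smul_smul, hT, Matrix.of_apply, sum_smul]
        rw [sum_comm_cycle]
        refine sum_congr rfl fun i _ => ?_
        refine sum_congr rfl fun k _ => sum_congr rfl fun m _ => ?_
        congr 1
        ring
      rw [hsum, ← sum_add_distrib]
      refine sum_congr rfl fun i _ => ?_
      rw [← add_smul, hS, Matrix.add_apply, add_assoc, h2, add_zero]

end CoordinateChange

/-! ### Splitting into even and odd vectors -/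

section ParityBlocks

variable {K : Type*} [Field K] {n : ℕ}

theorem ParityBlock.add {p : Fin n → ZMod 2} {A B : Matrix (Fin n) (Fin n) K}
    (hA : ParityBlock p A) (hB : ParityBlock p B) : ParityBlock p (A + B) := by
  intro i j hij
  by_cases h : A i j = 0
  · exact hB i j (by simpa [h] using hij)
  · exact hA i j h

theorem ParityBlock.sum {p : Fin n → ZMod 2} {ι : Type*} {s : Finset ι}
    {A : ι → Matrix (Fin n) (Fin n) K} (hA : ∀ i ∈ s, ParityBlock p (A i)) :
    ParityBlock p (∑ i ∈ s, A i) :=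
  Finset.sum_induction A (ParityBlock p) (fun _ _ => ParityBlock.add)
    (fun _ _ h => absurd rfl h) hA

theorem ParityBlock.single {p : Fin n → ZMod 2} {a b : Fin n} (h : p a = p b) (c : K) :
    ParityBlock p (Matrix.single a b c) := by
  intro i j hij
  by_cases h' : a = i ∧ b = j
  · rw [← h'.1, ← h'.2, h]
  · exact absurd (Matrix.single_apply_of_ne _ _ _ _ _ h') hij

/-- Respecting parity means commuting with the projection $D$ onto the even vectors, and whatever
commutes with $A$ commutes with $A^{-1}$. -/
theorem ParityBlock.nonsing_inv {p : Fin n → ZMod 2} {A : Matrix (Fin n) (Fin n) K}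
    (hA : ParityBlock p A) (hdet : IsUnit A.det) : ParityBlock p A⁻¹ := by
  set D : Matrix (Fin n) (Fin n) K := Matrix.diagonal fun i => if p i = 0 then 1 else 0 with hD
  have hcomm : Commute D A := by
    ext i j
    rw [hD, Matrix.diagonal_mul, Matrix.mul_diagonal]
    by_cases h : A i j = 0
    · simp [h]
    · rw [hA i j h, mul_comm]
  have h2 : ∀ a b : ZMod 2, (a = 0 ↔ b = 0) → a = b := by decide
  intro i j hij
  have hinv : Commute D A⁻¹ := by
    calc D * A⁻¹ = A⁻¹ * (A * D) * A⁻¹ := by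
          rw [Matrix.nonsing_inv_mul_cancel_left _ _ hdet]
      _ = A⁻¹ * D := by
          rw [← hcomm.eq, Matrix.mul_assoc, Matrix.mul_nonsing_inv_cancel_right _ _ hdet]
  have h := congrFun (congrFun hinv.eq i) j
  rw [hD, Matrix.diagonal_mul, Matrix.mul_diagonal,
    mul_comm] at h
  have h' := mul_left_cancel₀ hij h
  refine h2 _ _ ?_
  by_cases hi : p i = 0 <;> by_cases hj : p j = 0 <;> simp_all

theorem polar_matQuad_eq_zero_of_parity {p : Fin n → ZMod 2} {B : Matrix (Fin n) (Fin n) K}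
    (hB : ParityBlock p B) {e e' : ZMod 2} (he : e ≠ e') {v w : Fin n → K}
    (hv : VecParity p e v) (hw : VecParity p e' w) :
    QuadraticMap.polar (matQuad B) v w = 0 := by
  rw [polar_matQuad]
  refine sum_eq_zero fun i _ => sum_eq_zero fun j _ => ?_
  by_contra h
  have hij := hB i j (left_ne_zero_of_mul h)
  have h1 : ∀ i j, p i = p j → v i * w j = 0 := by
    intro i j hij
    by_contra h
    exact he ((hv i (left_ne_zero_of_mul h)).symm.trans
      (hij.trans (hw j (right_ne_zero_of_mul h))))
  rw [h1 i j hij, mul_comm (w i), h1 j i hij.symm, add_zero, mul_zero] at h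
  exact h rfl

/-- The inclusion of the vectors of parity `e`. -/
noncomputable def parityIncl (p : Fin n → ZMod 2) (e : ZMod 2) :
    ({i // p i = e} → K) →ₗ[K] (Fin n → K) where
  toFun v i := if h : p i = e then v ⟨i, h⟩ else 0
  map_add' v w := by
    ext i
    by_cases h : p i = e <;> simp [h]
  map_smul' c v := by
    ext i
    by_cases h : p i = e <;> simp [h]

theorem vecParity_parityIncl (p : Fin n → ZMod 2) (e : ZMod 2) (v : {i // p i = e} → K) :
    VecParity p e (parityIncl p e v) := by
  intro i hi
  by_contra h
  exact hi (dif_neg h)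

theorem parityIncl_injective (p : Fin n → ZMod 2) (e : ZMod 2) :
    Function.Injective (parityIncl (K := K) p e) := by
  intro v w h
  ext ⟨i, hi⟩
  simpa [parityIncl, hi] using congrFun h i

theorem exists_parityIncl_add (p : Fin n → ZMod 2) (e : ZMod 2) (w : Fin n → K) :
    ∃ w₀ w₁, w = parityIncl p e w₀ + parityIncl p (e + 1) w₁ := by
  refine ⟨fun i => w i, fun i => w i, ?_⟩
  have h2 : ∀ a e : ZMod 2, (a = e ∧ a ≠ e + 1) ∨ (a ≠ e ∧ a = e + 1) := by decide
  ext i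
  rcases h2 (p i) e with h | h <;> simp [parityIncl, h.1, h.2]

theorem polar_parityIncl_eq_zero {p : Fin n → ZMod 2} {B : Matrix (Fin n) (Fin n) K}
    (hB : ParityBlock p B) {e : ZMod 2} {v : {i // p i = e} → K}
    (h : ∀ w, QuadraticMap.polar ((matQuad B).comp (parityIncl p e)) v w = 0) (w : Fin n → K) :
    QuadraticMap.polar (matQuad B) (parityIncl p e v) w = 0 := by
  obtain ⟨w₀, w₁, rfl⟩ := exists_parityIncl_add p e w
  have h0 := h w₀
  simp only [QuadraticMap.polar, QuadraticMap.comp_apply, map_add] at h0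
  rw [QuadraticMap.polar_add_right, polar_matQuad_eq_zero_of_parity hB (by simp)
    (vecParity_parityIncl p e v) (vecParity_parityIncl p (e + 1) w₁), add_zero]
  exact h0

/-- Vectors of different parity are orthogonal, so a radical vector of one block is radical in the
whole space. On the even block the conclusion is weaker than what `MatNondeg` gives, but it lets
both blocks share one normal form. -/
theorem quadNondeg_parityIncl {p : Fin n → ZMod 2} {B : Matrix (Fin n) (Fin n) K}
    (hB : ParityBlock p B) (hB' : MatNondeg p B) (e : ZMod 2) :
    QuadNondeg ((matQuad B).comp (parityIncl p e)) := by
  intro v hv hq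
  refine parityIncl_injective p e ?_
  rw [map_zero]
  have h := polar_parityIncl_eq_zero hB hv
  rcases parity_eq_zero_or_one e with rfl | rfl
  · exact hB'.1 _ (vecParity_parityIncl p 0 v) h
  · exact hB'.2 _ (vecParity_parityIncl p 1 v) h hq

theorem exists_parity_family [IsAlgClosed K] [CharP K 2] {p : Fin n → ZMod 2}
    {B : Matrix (Fin n) (Fin n) K} (hB : ParityBlock p B) (hB' : MatNondeg p B) (e : ZMod 2)
    {k ε : ℕ} (hε : ε < 2) (hcard : Fintype.card {i // p i = e} = 2 * k + ε) :
    ∃ (u v : Fin k → Fin n → K) (g : Fin n → K), (∀ i, VecParity p e (u i)) ∧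
      (∀ i, VecParity p e (v i)) ∧ VecParity p e g ∧
      (∀ w, QuadraticMap.polar (matQuad B) g w = 0) ∧
      ∀ (a b : Fin k → K) (c : K), matQuad B (∑ i, a i • u i + ∑ i, b i • v i + c • g) =
        ∑ i, a i * b i + ε * (c * c) := by
  obtain ⟨u, v, g, hg, h⟩ := exists_hyperbolic_family ε hε k _ (quadNondeg_parityIncl hB hB' e)
    (by rw [Module.finrank_fintype_fun_eq_card, hcard])
  refine ⟨fun i => parityIncl p e (u i), fun i => parityIncl p e (v i), parityIncl p e g,
    fun i => vecParity_parityIncl p e _, fun i => vecParity_parityIncl p e _,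
    vecParity_parityIncl p e g, polar_parityIncl_eq_zero hB hg, fun a b c => ?_⟩
  rw [← h, QuadraticMap.comp_apply]
  simp only [map_add, map_sum, map_smul]

theorem even_card_of_matNondeg [IsAlgClosed K] [CharP K 2] {p : Fin n → ZMod 2}
    {B : Matrix (Fin n) (Fin n) K} (hB : ParityBlock p B) (hB' : MatNondeg p B) :
    Even (Fintype.card {i // p i = 0}) := by
  by_contra hodd
  obtain ⟨k, hk⟩ := Nat.not_even_iff_odd.1 hodd
  obtain ⟨u, v, g, -, -, hg, hrad, h⟩ := exists_parity_family hB hB' 0 (by norm_num) hk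
  -- In odd dimension the leftover vector $g$ has $q(g)=1$; yet it is even and in the radical, hence
  -- zero.
  have h1 := h 0 0 1
  rw [hB'.1 g hg hrad] at h1
  simp at h1

end ParityBlocks

/-! ### The canonical matrices and congruence to them -/

section Layout

variable {K : Type*} [Field K] {n k l ε : ℕ}

/-- An arrangement of the indices `1, …, n` into `k` pairs of even coordinates `p_i`, `q_i`, `l` pairs
of odd coordinates `ξ_i`, `η_i` and `ε` odd coordinates `θ`. -/
abbrev Layout (n k l ε : ℕ) : Type :=
  ((Fin k ⊕ Fin l) ⊕ (Fin k ⊕ Fin l)) ⊕ Fin ε ≃ Fin n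

/-- The parities of the coordinates `p_i`, `q_i`, `ξ_i`, `η_i`, `θ`. -/
def layoutParity (k l ε : ℕ) : ((Fin k ⊕ Fin l) ⊕ (Fin k ⊕ Fin l)) ⊕ Fin ε → ZMod 2 :=
  Sum.elim (Sum.elim (Sum.elim 0 1) (Sum.elim 0 1)) 1

/-- The matrix of `∑ p_i dq_i + ∑ ξ_i dη_i + ∑ θ dθ`. -/
noncomputable def layoutMatrix (K : Type*) [Field K] (σ : Layout n k l ε) :
    Matrix (Fin n) (Fin n) K :=
  ∑ i, Matrix.single (σ (.inl (.inl i))) (σ (.inl (.inr i))) 1 +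
    ∑ i, Matrix.single (σ (.inr i)) (σ (.inr i)) 1

/-- Values in an arbitrary module let the same identity expand both quadratic forms and 1-forms. -/
theorem sum_layoutMatrix_smul {M : Type*} [AddCommGroup M] [Module K M] (σ : Layout n k l ε)
    (g : Fin n → Fin n → M) : ∑ i, ∑ j, layoutMatrix K σ i j • g i j =
      ∑ i, g (σ (.inl (.inl i))) (σ (.inl (.inr i))) + ∑ i, g (σ (.inr i)) (σ (.inr i)) := by
  let F : Matrix (Fin n) (Fin n) K →+ M :=
    { toFun := fun A => ∑ i, ∑ j, A i j • g i j
      map_zero' := by simp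
      map_add' := fun A B => by simp [add_smul, sum_add_distrib] }
  have hF : ∀ a b, F (Matrix.single a b 1) = g a b := by
    intro a b
    change ∑ i, ∑ j, Matrix.single a b (1 : K) i j • g i j = g a b
    simp [Matrix.single_apply, ite_and]
  change F (layoutMatrix K σ) = _
  simp only [layoutMatrix, map_add, map_sum, hF]

theorem matQuad_layoutMatrix (σ : Layout n k l ε) (v : Fin n → K) :
    matQuad (layoutMatrix K σ) v =
      ∑ i, v (σ (.inl (.inl i))) * v (σ (.inl (.inr i))) +
        ∑ i, v (σ (.inr i)) * v (σ (.inr i)) := by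
  rw [matQuad_apply, ← sum_layoutMatrix_smul (K := K) σ fun i j => v i * v j]
  rfl

theorem polar_layoutMatrix_single [CharP K 2] (σ : Layout n k l ε) (v : Fin n → K)
    (i : Fin k ⊕ Fin l) :
    QuadraticMap.polar (matQuad (layoutMatrix K σ)) v (Pi.single (σ (.inl (.inl i))) 1) =
        v (σ (.inl (.inr i))) ∧
      QuadraticMap.polar (matQuad (layoutMatrix K σ)) v (Pi.single (σ (.inl (.inr i))) 1) =
        v (σ (.inl (.inl i))) := by
  simp only [polar_matQuad]
  have h := fun w : Fin n → K => sum_layoutMatrix_smul (K := K) σ fun i j => v i * w j + w i * v j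
  simp only [smul_eq_mul] at h
  rw [h, h]
  simp [Pi.single_apply]

theorem quadNondeg_layoutMatrix [CharP K 2] (hε : ε < 2) (σ : Layout n k l ε) :
    QuadNondeg (matQuad (layoutMatrix K σ)) := by
  intro v hv hq
  have h1 : ∀ i, v (σ (.inl (.inl i))) = 0 := fun i => by
    rw [← (polar_layoutMatrix_single σ v i).2, hv]
  have h2 : ∀ i, v (σ (.inl (.inr i))) = 0 := fun i => by
    rw [← (polar_layoutMatrix_single σ v i).1, hv]
  have h3 : ∀ i, v (σ (.inr i)) = 0 := by
    intro i
    have : Subsingleton (Fin ε) := Fin.subsingleton_iff_le_one.2 (by omega)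
    rw [matQuad_layoutMatrix, Fintype.sum_subsingleton _ i] at hq
    simpa [h1] using hq
  ext j
  obtain ⟨z, rfl⟩ := σ.surjective j
  rcases z with (i | i) | i
  · exact h1 i
  · exact h2 i
  · exact h3 i

/-- An even vector has no $\theta$-coordinate, so the quadratic form vanishes automatically on even
radical vectors. This gives the stronger condition required of them. -/
theorem matNondeg_layoutMatrix [CharP K 2] (hε : ε < 2) {σ : Layout n k l ε} {p : Fin n → ZMod 2}
    (hσ : ∀ z, p (σ z) = layoutParity k l ε z) : MatNondeg p (layoutMatrix K σ) := by
  refine ⟨fun v hv hb => quadNondeg_layoutMatrix hε σ v hb ?_,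
    fun v _ hb hq => quadNondeg_layoutMatrix hε σ v hb hq⟩
  have h1 : ∀ i, v (σ (.inl (.inl i))) = 0 := fun i => by
    rw [← (polar_layoutMatrix_single σ v i).2, hb]
  have h3 : ∀ i, v (σ (.inr i)) = 0 := by
    intro i
    by_contra h
    have h' := hv _ h
    rw [hσ] at h'
    exact one_ne_zero h'
  simp [matQuad_layoutMatrix, h1, h3]

theorem parityBlock_layoutMatrix {σ : Layout n k l ε} {p : Fin n → ZMod 2}
    (hσ : ∀ z, p (σ z) = layoutParity k l ε z) : ParityBlock p (layoutMatrix K σ) := by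
  refine ParityBlock.add (ParityBlock.sum fun i _ => ParityBlock.single ?_ 1)
    (ParityBlock.sum fun i _ => ParityBlock.single rfl 1)
  rw [hσ, hσ]
  rfl

theorem card_parity {σ : Layout n k l ε} {p : Fin n → ZMod 2}
    (hσ : ∀ z, p (σ z) = layoutParity k l ε z) :
    Fintype.card {i // p i = 0} = 2 * k ∧ Fintype.card {i // p i = 1} = 2 * l + ε := by
  have h : ∀ e, Fintype.card {i // p i = e} =
      ∑ z, if layoutParity k l ε z = e then 1 else 0 := by
    intro e
    rw [Fintype.card_subtype, card_filter, ← σ.sum_comp]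
    simp only [hσ]
  rw [h, h]
  simp [layoutParity, Fintype.sum_sum_type]
  omega

theorem VecParity.add {p : Fin n → ZMod 2} {e : ZMod 2} {v w : Fin n → K}
    (hv : VecParity p e v) (hw : VecParity p e w) : VecParity p e (v + w) := by
  intro i hi
  by_cases h : v i = 0
  · exact hw i (by simpa [h] using hi)
  · exact hv i h

theorem VecParity.smul {p : Fin n → ZMod 2} {e : ZMod 2} {v : Fin n → K}
    (hv : VecParity p e v) (c : K) : VecParity p e (c • v) :=
  fun i hi => hv i (right_ne_zero_of_mul hi)

theorem VecParity.sum {p : Fin n → ZMod 2} {e : ZMod 2} {ι : Type*} {s : Finset ι}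
    {v : ι → Fin n → K} (hv : ∀ i ∈ s, VecParity p e (v i)) : VecParity p e (∑ i ∈ s, v i) :=
  Finset.sum_induction v (VecParity p e) (fun _ _ => VecParity.add)
    (fun _ h => absurd rfl h) hv

/-- The normal-form vectors of the two parity blocks, placed in the columns prescribed by $\sigma$,
form a matrix $U$ with $q_B\circ U$ canonical; the required matrix is $U^{-1}$. -/
theorem exists_congruence [IsAlgClosed K] [CharP K 2] (hε : ε < 2) {σ : Layout n k l ε}
    {p : Fin n → ZMod 2} (hσ : ∀ z, p (σ z) = layoutParity k l ε z)
    {B : Matrix (Fin n) (Fin n) K} (hB : ParityBlock p B) (hB' : MatNondeg p B) :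
    ∃ A : Matrix (Fin n) (Fin n) K, ParityBlock p A ∧ IsUnit A.det ∧
      ∀ v, matQuad B v = matQuad (layoutMatrix K σ) (A.mulVec v) := by
  obtain ⟨u₀, v₀, g₀, hu₀, hv₀, -, -, h₀⟩ :=
    exists_parity_family hB hB' 0 (ε := 0) (by norm_num) (card_parity hσ).1
  obtain ⟨u₁, v₁, g, hu₁, hv₁, hg, -, h₁⟩ :=
    exists_parity_family hB hB' 1 hε (card_parity hσ).2
  let t : ((Fin k ⊕ Fin l) ⊕ (Fin k ⊕ Fin l)) ⊕ Fin ε → Fin n → K :=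
    Sum.elim (Sum.elim (Sum.elim u₀ u₁) (Sum.elim v₀ v₁)) fun _ => g
  have ht : ∀ z, VecParity p (layoutParity k l ε z) (t z) := by
    rintro (((i | i) | (i | i)) | i)
    · exact hu₀ i
    · exact hu₁ i
    · exact hv₀ i
    · exact hv₁ i
    · exact hg
  let U : Matrix (Fin n) (Fin n) K := Matrix.of fun i j => t (σ.symm j) i
  have hU : ParityBlock p U := by
    intro i j hij
    have h1 := ht (σ.symm j) i hij
    rw [h1, ← hσ, Equiv.apply_symm_apply]
  have hmul : ∀ x, U.mulVec x = ∑ z, x (σ z) • t z := by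
    intro x
    ext i
    rw [Finset.sum_apply, Matrix.mulVec, dotProduct, ← σ.sum_comp]
    refine sum_congr rfl fun z _ => ?_
    simp [U, mul_comm]
  have hq : ∀ x, matQuad B (U.mulVec x) = matQuad (layoutMatrix K σ) x := by
    intro x
    have hsplit : U.mulVec x =
        (∑ i, x (σ (.inl (.inl (.inl i)))) • u₀ i + ∑ i, x (σ (.inl (.inr (.inl i)))) • v₀ i +
          (0 : K) • g₀) +
        (∑ i, x (σ (.inl (.inl (.inr i)))) • u₁ i + ∑ i, x (σ (.inl (.inr (.inr i)))) • v₁ i +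
          (∑ i, x (σ (.inr i))) • g) := by
      rw [hmul]
      simp only [Fintype.sum_sum_type, t, Sum.elim_inl, Sum.elim_inr, zero_smul, sum_smul]
      abel
    have hsq : (ε : K) * ((∑ i, x (σ (.inr i))) * ∑ i, x (σ (.inr i))) =
        ∑ i, x (σ (.inr i)) * x (σ (.inr i)) := by
      obtain rfl | rfl : ε = 0 ∨ ε = 1 := by omega
      · simp
      · simp
    rw [hsplit, quad_add, h₀, h₁, polar_matQuad_eq_zero_of_parity hB zero_ne_one, hsq,
      matQuad_layoutMatrix, Fintype.sum_sum_type]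
    · push_cast
      ring
    · exact ((VecParity.sum fun i _ => (hu₀ i).smul _).add
        (VecParity.sum fun i _ => (hv₀ i).smul _)).add
          (by rw [zero_smul]; exact fun _ h => absurd rfl h)
    · exact ((VecParity.sum fun i _ => (hu₁ i).smul _).add
        (VecParity.sum fun i _ => (hv₁ i).smul _)).add (hg.smul _)
  have hunit : IsUnit U.det := by
    -- A vector in the kernel of $U$ is a radical zero of $q_B\circ U$, which is the canonical form
    -- and is non-degenerate.
    rw [← Matrix.isUnit_iff_isUnit_det, ← Matrix.mulVec_injective_iff_isUnit]
    refine (injective_iff_map_eq_zero U.mulVecLin).2 fun x hx => ?_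
    rw [Matrix.mulVecLin_apply] at hx
    refine quadNondeg_layoutMatrix hε σ x (fun w => ?_) ?_
    · simp only [QuadraticMap.polar, ← hq, Matrix.mulVec_add, hx]
      simp
    · rw [← hq, hx, QuadraticMap.map_zero]
  refine ⟨U⁻¹, hU.nonsing_inv hunit, U.isUnit_nonsing_inv_det hunit, fun v => ?_⟩
  rw [← hq, Matrix.mulVec_mulVec, Matrix.mul_nonsing_inv _ hunit, Matrix.one_mulVec]

end Layout

/-! ### Standard ordering of the coordinates and the classification -/

section Classification

variable {K : Type*} [Field K] {n k l ε : ℕ}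

theorem isOddContact_layout [CharP K 2] {p : Fin (n + 1) → ZMod 2} {N : Fin (n + 1) → ℕ∞}
    (hn : 0 < n) (hp : p 0 = 0) (hN : IsShearing p N) (hε : ε < 2) {σ : Layout n k l ε}
    (hσ : ∀ z, p (σ z).succ = layoutParity k l ε z) :
    IsOddContact p N (formOf (layoutMatrix K σ) (coord K)) := by
  rw [formOf_coord, isOddContact_bilinForm hn hp hN]
  exact ⟨parityBlock_layoutMatrix hσ, matNondeg_layoutMatrix hε hσ⟩

theorem isOddContact_iff_exists_coordSystem [IsAlgClosed K] [CharP K 2]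
    {p : Fin (n + 1) → ZMod 2} {N : Fin (n + 1) → ℕ∞} (hn : 0 < n) (hp : p 0 = 0)
    (hN : IsShearing p N) (hε : ε < 2) {σ : Layout n k l ε}
    (hσ : ∀ z, p (σ z).succ = layoutParity k l ε z) (B : Matrix (Fin n) (Fin n) K) :
    IsOddContact p N (bilinForm B) ↔
      ∃ y, IsCoordSystem p N y ∧ bilinForm B = formOf (layoutMatrix K σ) y := by
  rw [isOddContact_bilinForm hn hp hN]
  have hblock : ParityBlock (fun i => p i.succ) (layoutMatrix K σ) := parityBlock_layoutMatrix hσ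
  constructor
  · rintro ⟨hB, hB'⟩
    obtain ⟨A, hA, hdet, h⟩ := exists_congruence hε (p := fun i => p i.succ) hσ hB hB'
    exact exists_coordSystem hp hN hB hblock hA hdet h
  · rintro ⟨y, hy, h⟩
    exact contact_of_coordSystem hp hN hy hblock (matNondeg_layoutMatrix hε hσ) h

theorem even_card_of_isOddContact [IsAlgClosed K] [CharP K 2]
    {p : Fin (n + 1) → ZMod 2} {N : Fin (n + 1) → ℕ∞} (hn : 0 < n) (hp : p 0 = 0)
    (hN : IsShearing p N) {B : Matrix (Fin n) (Fin n) K} (h : IsOddContact p N (bilinForm B)) :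
    Even (Fintype.card {i : Fin n // p i.succ = 0}) := by
  obtain ⟨hB, hB'⟩ := (isOddContact_bilinForm hn hp hN B).1 h
  exact even_card_of_matNondeg (p := fun i => p i.succ) hB hB'

/-- The positions of the coordinates `p_i`, `q_i`, `ξ_i`, `η_i`, `θ` among `n = n₀ + n₁`. -/
def layoutFun (n n₀ n₁ : ℕ) (h : n₀ + n₁ = n) :
    ((Fin (n₀ / 2) ⊕ Fin (n₁ / 2)) ⊕ (Fin (n₀ / 2) ⊕ Fin (n₁ / 2))) ⊕ Fin (n₁ % 2) → Fin n
  | .inl (.inl (.inl i)) => ⟨i, by omega⟩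
  | .inl (.inl (.inr i)) => ⟨n₀ + i, by omega⟩
  | .inl (.inr (.inl i)) => ⟨n₀ / 2 + i, by omega⟩
  | .inl (.inr (.inr i)) => ⟨n₀ + n₁ / 2 + i, by omega⟩
  | .inr i => ⟨n - 1, by have := i.isLt; omega⟩

theorem layoutFun_bijective (n n₀ n₁ : ℕ) (h : n₀ + n₁ = n) (hn₀ : Even n₀) :
    Function.Bijective (layoutFun n n₀ n₁ h) := by
  obtain ⟨k, hk⟩ := hn₀
  rw [Fintype.bijective_iff_injective_and_card]
  constructor
  · rintro (((i | i) | (i | i)) | i) (((j | j) | (j | j)) | j) hij <;>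
      have hi := i.isLt <;>
      have hj := j.isLt <;>
      simp only [layoutFun, Fin.mk.injEq] at hij <;>
      first
        | (exfalso; omega)
        | simp only [Sum.inl.injEq, Sum.inr.injEq]; exact Fin.ext (by omega)
  -- The blocks have $2\lfloor n_0/2\rfloor+2\lfloor n_1/2\rfloor+(n_1\bmod 2)$ elements, which is
  -- $n$ because $n_0$ is even.
  · simp only [Fintype.card_sum, Fintype.card_fin]
    omega

/-- The arrangement `p`, `q`, `ξ`, `η`, `θ` of `n = n₀ + n₁` coordinates, `n₀` being even. -/
noncomputable def standardLayout (n n₀ n₁ : ℕ) (h : n₀ + n₁ = n) (hn₀ : Even n₀) :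
    Layout n (n₀ / 2) (n₁ / 2) (n₁ % 2) :=
  Equiv.ofBijective _ (layoutFun_bijective n n₀ n₁ h hn₀)

theorem standardLayout_apply (n n₀ n₁ : ℕ) (h : n₀ + n₁ = n) (hn₀ : Even n₀) (z) :
    standardLayout n n₀ n₁ h hn₀ z = layoutFun n n₀ n₁ h z := rfl

theorem parity_standardLayout {n n₀ n₁ : ℕ} (h : n₀ + n₁ = n) (hn₀ : Even n₀)
    {p : Fin n → ZMod 2} (hp : ∀ i, p i = if (i : ℕ) < n₀ then 0 else 1) (z) :
    p (standardLayout n n₀ n₁ h hn₀ z) = layoutParity (n₀ / 2) (n₁ / 2) (n₁ % 2) z := by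
  rw [hp, standardLayout_apply]
  rcases z with ((i | i) | (i | i)) | i
  · exact if_pos (by simp only [layoutFun]; omega)
  · exact if_neg (by simp only [layoutFun]; omega)
  · exact if_pos (by simp only [layoutFun]; omega)
  · exact if_neg (by simp only [layoutFun]; omega)
  · exact if_neg (by have := i.isLt; simp only [layoutFun]; omega)

theorem formOf_standardLayout {n n₀ n₁ : ℕ} (h : n₀ + n₁ = n) (hn₀ : Even n₀)
    (y : Fin (n + 1) → DivPow K (Fin (n + 1))) :
    formOf (layoutMatrix K (standardLayout n n₀ n₁ h hn₀)) y =
      diff (y 0) +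
      ∑ i : Fin (n₀ / 2), y ⟨i + 1, by omega⟩ • diff (y ⟨n₀ / 2 + (i + 1), by omega⟩) +
      ∑ i : Fin (n₁ / 2), y ⟨n₀ + (i + 1), by omega⟩ • diff (y ⟨n₀ + n₁ / 2 + (i + 1), by omega⟩) +
      if Odd n₁ then y (Fin.last _) • diff (y (Fin.last _)) else 0 := by
  rw [formOf, sum_layoutMatrix_smul _ fun i j => y i.succ • diff (y j.succ), Fintype.sum_sum_type]
  rw [← add_assoc, ← add_assoc]
  refine congrArg₂ (· + ·) rfl ?_
  by_cases hodd : Odd n₁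
  · have h1 := Nat.odd_iff.1 hodd
    have hi : ∀ i : Fin (n₁ % 2), (standardLayout n n₀ n₁ h hn₀ (.inr i)).succ = Fin.last n := by
      intro i
      refine Fin.ext ?_
      simp only [standardLayout_apply, layoutFun, Fin.succ_mk, Fin.val_last]
      omega
    simp only [hi, sum_const, card_univ, Fintype.card_fin, h1, one_smul, if_pos hodd]
  · have h1 : n₁ % 2 = 0 := Nat.even_iff.1 (Nat.not_odd_iff_even.1 hodd)
    have : IsEmpty (Fin (n₁ % 2)) := by rw [h1]; infer_instance
    rw [if_neg hodd, Fintype.sum_empty]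

theorem card_lt {n n₀ n₁ : ℕ} (h : n₀ + n₁ = n) {p : Fin n → ZMod 2}
    (hp : ∀ i, p i = if (i : ℕ) < n₀ then 0 else 1) : Fintype.card {i // p i = 0} = n₀ := by
  have hiff : ∀ i, p i = 0 ↔ (i : ℕ) < n₀ := fun i => by
    rw [hp]
    by_cases hi : (i : ℕ) < n₀ <;> simp [hi]
  simp only [Fintype.card_subtype, hiff]
  rw [Fin.card_filter_val_lt]
  omega

/-- Keeping $n$ and the canonical expression as variables, tied to $n_0,n_1$ only by equations, lets
one statement serve both the equal-parity and the mixed case. -/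
theorem classification [IsAlgClosed K] [CharP K 2] {n n₀ n₁ : ℕ} (h : n₀ + n₁ = n) (hn : 0 < n)
    {p : Fin (n + 1) → ZMod 2} {N : Fin (n + 1) → ℕ∞} (hp : p 0 = 0)
    (hp' : ∀ i : Fin n, p i.succ = if (i : ℕ) < n₀ then 0 else 1) (hN : IsShearing p N)
    {canon : (Fin (n + 1) → DivPow K (Fin (n + 1))) → Fin (n + 1) → DivPow K (Fin (n + 1))}
    (hcanon : ∀ y, canon y = diff (y 0) +
      ∑ i : Fin (n₀ / 2), y ⟨i + 1, by omega⟩ • diff (y ⟨n₀ / 2 + (i + 1), by omega⟩) +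
      ∑ i : Fin (n₁ / 2), y ⟨n₀ + (i + 1), by omega⟩ • diff (y ⟨n₀ + n₁ / 2 + (i + 1), by omega⟩) +
      if Odd n₁ then y (Fin.last _) • diff (y (Fin.last _)) else 0) (hn₀ : Even n₀) :
    IsOddContact p N (canon (coord K)) ∧ ∀ B : Matrix (Fin n) (Fin n) K,
      IsOddContact p N (bilinForm B) ↔ ∃ y, IsCoordSystem p N y ∧ bilinForm B = canon y := by
  have hσ := parity_standardLayout h hn₀ (p := fun i => p i.succ) hp'
  have hε : n₁ % 2 < 2 := Nat.mod_lt _ (by norm_num)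
  simp only [hcanon, ← formOf_standardLayout h hn₀]
  exact ⟨isOddContact_layout hn hp hN hε hσ,
    isOddContact_iff_exists_coordSystem hn hp hN hε hσ⟩

theorem not_isOddContact_of_odd [IsAlgClosed K] [CharP K 2] {n n₀ n₁ : ℕ} (h : n₀ + n₁ = n)
    (hn : 0 < n) {p : Fin (n + 1) → ZMod 2} {N : Fin (n + 1) → ℕ∞} (hp : p 0 = 0)
    (hp' : ∀ i : Fin n, p i.succ = if (i : ℕ) < n₀ then 0 else 1) (hN : IsShearing p N)
    (hn₀ : Odd n₀) (B : Matrix (Fin n) (Fin n) K) : ¬ IsOddContact p N (bilinForm B) := by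
  intro hB
  have h1 := even_card_of_isOddContact hn hp hN hB
  rw [card_lt h (p := fun i => p i.succ) hp'] at h1
  exact Nat.not_even_iff_odd.2 hn₀ h1

end Classification

end OddContact

theorem mainTheorem6 (K : Type*) [Field K] [IsAlgClosed K] [CharP K 2] :
    -- `x_1, …, x_n` all of the same parity `e`
    (∀ (n : ℕ), 0 < n → ∀ (e : ZMod 2) (N : Fin (n + 1) → ℕ∞),
      OddContact.IsShearing (OddContact.pureParity n e) N →
      (Even n ∨ e = 1 →
        OddContact.IsOddContact (OddContact.pureParity n e) N
          (OddContact.canonForm (OddContact.coord K)) ∧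
        ∀ B : Matrix (Fin n) (Fin n) K,
          OddContact.IsOddContact (OddContact.pureParity n e) N (OddContact.bilinForm B) ↔
          ∃ y, OddContact.IsCoordSystem (OddContact.pureParity n e) N y ∧
            OddContact.bilinForm B = OddContact.canonForm y) ∧
      (Odd n ∧ e = 0 → ∀ B : Matrix (Fin n) (Fin n) K,
        ¬ OddContact.IsOddContact (OddContact.pureParity n e) N (OddContact.bilinForm B))) ∧
    -- `x_1, …, x_{n₀}` even and `x_{n₀+1}, …, x_{n₀+n₁}` odd
    (∀ (n₀ n₁ : ℕ), 0 < n₀ + n₁ → ∀ (N : Fin (n₀ + n₁ + 1) → ℕ∞),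
      OddContact.IsShearing (OddContact.mixedParity n₀ n₁) N →
      (Even n₀ →
        OddContact.IsOddContact (OddContact.mixedParity n₀ n₁) N
          (OddContact.canonSuperForm n₀ n₁ (OddContact.coord K)) ∧
        ∀ B : Matrix (Fin (n₀ + n₁)) (Fin (n₀ + n₁)) K,
          OddContact.IsOddContact (OddContact.mixedParity n₀ n₁) N (OddContact.bilinForm B) ↔
          ∃ y, OddContact.IsCoordSystem (OddContact.mixedParity n₀ n₁) N y ∧
            OddContact.bilinForm B = OddContact.canonSuperForm n₀ n₁ y) ∧
      (Odd n₀ → ∀ B : Matrix (Fin (n₀ + n₁)) (Fin (n₀ + n₁)) K,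
        ¬ OddContact.IsOddContact (OddContact.mixedParity n₀ n₁) N (OddContact.bilinForm B))) := by
  refine ⟨fun n hn e N hN => ?_, fun n₀ n₁ hn N hN => ?_⟩
  · have hp0 : OddContact.pureParity n e 0 = 0 := rfl
    rcases OddContact.parity_eq_zero_or_one e with rfl | rfl
    · have hp : ∀ i : Fin n, OddContact.pureParity n 0 i.succ = if (i : ℕ) < n then 0 else 1 := by
        intro i
        simp [OddContact.pureParity]
      refine ⟨fun h => ?_, fun h => OddContact.not_isOddContact_of_odd (n₁ := 0) rfl hn hp0 hp hN h.1⟩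
      have heven : Even n := h.resolve_right (by decide)
      -- The all-even case is the mixed one with $n_1=0$: the sum of $\xi_i\,d\eta_i$ is empty, and
      -- evenness of $n$ removes the last term of `canonForm`.
      refine OddContact.classification (n₁ := 0) rfl hn hp0 hp hN (fun y => ?_) heven
      simp [OddContact.canonForm, heven]
    · have hp : ∀ i : Fin n, OddContact.pureParity n 1 i.succ = if (i : ℕ) < 0 then 0 else 1 := by
        intro i
        simp [OddContact.pureParity]
      refine ⟨fun _ => ?_, fun h => absurd h.2 (by decide)⟩
      refine OddContact.classification (n₀ := 0) (zero_add n) hn hp0 hp hN (fun y => ?_) Even.zero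
      simp [OddContact.canonForm]
  · have hp0 : OddContact.mixedParity n₀ n₁ 0 = 0 := by simp [OddContact.mixedParity]
    have hp : ∀ i : Fin (n₀ + n₁),
        OddContact.mixedParity n₀ n₁ i.succ = if (i : ℕ) < n₀ then 0 else 1 := by
      intro i
      simp [OddContact.mixedParity]
    exact ⟨OddContact.classification rfl hn hp0 hp hN fun _ => rfl,
      OddContact.not_isOddContact_of_odd rfl hn hp0 hp hN⟩
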